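/- Let $D$ be a planar diagram of a link with $n$ crossings, with finitely many marks $m$ placed on its edges, and with an orientation of each crossing $c$, i.e. an arrow on the arc that joins the two strands of the $0$-resolution of $c$. Put $R=\mathbb Z[x_m]$, one variable for each mark. For a complete resolution $\rho\in\{0,1\}^n$ let $V_\rho$ be the exterior $R$-algebra on the circles of $\rho$, and let $C=\bigoplus_\rho V_\rho$. *Horizontal differential.* For an edge $\rho\to\rho'$ of the cube of resolutions (the crossing $c$ changes from $0$ to $1$) the naive map $V_\rho\to V_{\rho'}$ identifies two generators if two circles are joined, and is $\pi\mapsto (b-b')\pi$, $a\pi\mapsto bb'\pi$ ($\pi$ a product of other circles) if $a$ is split into $b,b'$, where the arrow of $c$, turned counterclockwise by $90^\circ$, points from $b$ to $b'$. A sign assignment $\varepsilon$ attaches a sign to each edge of the cube so that the sum $d_{odd}$ of the signed naive maps satisfies $d_{odd}^2=0$, with the following convention on the faces whose naive maps both commute and anticommute (one circle carrying two arcs $c,e$, on opposite sides, with interleaved ends). Walk on the circle from the tail to the head of the arrow of $c$ with this arrow on the left. If one meets the tail of the arrow of $e$ (type $X$), the product of the four signs of the face is $+1$ (the naive face is counted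 as anticommuting). If one meets its head (type $Y$), the product is $-1$ (the naive face is counted as commuting). *Vertical differential.* Let $s(\rho)=\pm1$ be signs on the vertices of the cube, equal at the two ends of each split edge and opposite at the two ends of each join edge. On $V_\rho$ let $d_v$ be $s(\rho)$ times left multiplication by $\sum_a w_a a$, where $a$ runs over the circles of $\rho$ and $w_a$ is the sum of the $x_m$ over the marks $m$ on $a$. **Theorem.** Let the marked diagram $D'$ be obtained from $D$ by sliding one mark $m$ under a crossing $c$ (from the edge at one end of the under-strand of $c$ to the edge at the opposite end), with the same crossing orientations, and use the same $\varepsilon$ and $s$ for $D$ and $D'$. Then $(C,d_v+d_{odd})$ for $D$ and for $D'$ are complexes, i.e. their differentials square to zero, and they are isomorphic. An isomorphism is $F=\mathrm{id}+H$, where $H$ maps the summand $V_{\rho,1}$ to $V_{\rho,0}$, for every resolution $\rho$ of the crossings other than $c$, by $$\eta\;\varepsilon\big((\rho,0)\to(\rho,1)\big)\;s(\rho,1)\;x_m\cdot h_\rho ,$$ and is zero on all $V_{\rho,0}$. Here $(\rho,i)$ is the complete resolution with the $i$-resolution at $c$, and $h_\rho$ is the naive map for changing the $1$-resolution of $c$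 back to the $0$-resolution along the arrow of $c$ turned counterclockwise by $90^\circ$. The sign $\eta$ depends only on the arrow of $c$: in the $0$-resolution of $c$, $\eta=+1$ if the arrow starts on the strand through the end of $c$ to which the mark moves, and $\eta=-1$ if it starts on the strand through the end from which the mark moves. -/

import Mathlib

namespace TwistedOdd

/-- The two pairings of the four ends `0, 1, 2, 3` at a crossing. The ends are numbered
counterclockwise and the under-strand runs through `0` and `2`, the over-strand through `1` and
`3`. The `0`-resolution joins `0 - 1` and `2 - 3`, the `1`-resolution joins `0 - 3` and `1 - 2`
(so the `0`-resolution joins the two regions swept out by turning the over-strand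
counterclockwise). -/
def smoothing : Bool → Fin 4 → Fin 4
  | false => ![1, 0, 3, 2]
  | true => ![3, 2, 1, 0]

/-- A link diagram on the sphere with `n` crossings and `l` circles without crossings (a planar
diagram code). An edge is a pair `{d, glue d}` of ends of crossings.

The diagram determines a closed oriented surface with the four-valent graph drawn on it. The
sector at crossing `c` between the ends `i` and `i + 1` is named `(c, i)`; the sectors to the
left and to the right of the end `(c, i)` (looking away from `c`) are `(c, i)` and `(c, i - 1)`,
and the left-hand sector at one end of an edge lies in the same region as the right-hand sector
at the other end. -/
structure LinkDiagram (n l : ℕ) where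
  glue : Fin n × Fin 4 → Fin n × Fin 4
  glue_glue : ∀ d, glue (glue d) = d
  glue_ne : ∀ d, glue d ≠ d
  /-- The surface is a sphere (one for each connected component of the graph), in the form of the
  Jordan curve property: every mod `2` cycle `S` of edges is the boundary between the regions of
  colour `0` and those of colour `1`, for some colouring of the regions. Equivalently the first
  mod `2` homology of the surface vanishes, or the Euler characteristic is twice the number of
  components. -/
  planar : ∀ S : Fin n × Fin 4 → ZMod 2,
    (∀ d, S (glue d) = S d) → (∀ c, ∑ i, S (c, i) = 0) →
    ∃ colour : Fin n × Fin 4 → ZMod 2,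
      (∀ c i, colour (c, i) = colour ((glue (c, i)).1, (glue (c, i)).2 - 1)) ∧
      (∀ c i, S (c, i) = colour (c, i) - colour (c, i - 1))

/-- A complete resolution: `ρ c = false` is the `0`-resolution at `c`, `ρ c = true` the
`1`-resolution. -/
abbrev Resolution (n : ℕ) : Type := Fin n → Bool

/-- The coefficient ring `ℤ[x_m]`, one variable for each mark. -/
abbrev MarkRing (M : Type*) : Type _ := MvPolynomial M ℤ

/-- An orientation of the crossings. The arrow at a crossing `c` is an arc in the `0`-resolution of
`c` which joins the strand through the ends `0, 1` to the strand through the ends `2, 3`: it points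
from the former to the latter if `o c = true` and the other way if `o c = false`. -/
abbrev CrossingOrientation (n : ℕ) : Type := Fin n → Bool

/-- The arrow at `c` starts on the strand of the `0`-resolution through the ends
`arrowTail o c` and `arrowTail o c + 1`. -/
def arrowTail {n : ℕ} (o : CrossingOrientation n) (c : Fin n) : Fin 4 := if o c then 0 else 2

namespace LinkDiagram

variable {n l : ℕ} (D : LinkDiagram n l)

/-- Ends of crossings, together with the circles without crossings. A point stands for the edge of
the diagram (or the circle without crossings) that it lies on. -/
abbrev Point (_D : LinkDiagram n l) : Type := (Fin n × Fin 4) ⊕ Fin l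

/-- Two points name the same edge of the diagram. -/
def SameEdge (p q : D.Point) : Prop :=
  p = q ∨ ∃ d, p = Sum.inl d ∧ q = Sum.inl (D.glue d)

/-- Points that are neighbours on a circle of the resolution `ρ`: the two ends of an edge, or two
ends of a crossing that are joined by the resolution. -/
inductive Joined (ρ : Resolution n) : D.Point → D.Point → Prop
  | edge (d : Fin n × Fin 4) : Joined ρ (Sum.inl d) (Sum.inl (D.glue d))
  | corner (c : Fin n) (i : Fin 4) :
      Joined ρ (Sum.inl (c, i)) (Sum.inl (c, smoothing (ρ c) i))

/-- The circles of the resolution `ρ`. -/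
def Circle (ρ : Resolution n) : Type := Quot (D.Joined ρ)

/-- The circle of `ρ` through a point. -/
def circleOf (ρ : Resolution n) (p : D.Point) : D.Circle ρ := Quot.mk _ p

instance (ρ : Resolution n) : Finite (D.Circle ρ) :=
  inferInstanceAs (Finite (Quot (D.Joined ρ)))

noncomputable instance (ρ : Resolution n) : Fintype (D.Circle ρ) := Fintype.ofFinite _

/-- The two strands of `ρ` at the crossing `c` lie on one circle, so that changing the resolution
of `c` splits this circle in two. Otherwise the change joins two circles. -/
def IsSplit (ρ : Resolution n) (c : Fin n) : Prop :=
  D.circleOf ρ (Sum.inl (c, 0)) = D.circleOf ρ (Sum.inl (c, 2))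

noncomputable section

variable (M : Type*)

/-- `V_ρ`, the cohomology ring with coefficients `ℤ[x_m]` of a product of copies of `S¹`, one for
each circle of `ρ`: the exterior algebra on the circles of `ρ`. -/
abbrev V (ρ : Resolution n) : Type _ :=
  ExteriorAlgebra (MarkRing M) (D.Circle ρ →₀ MarkRing M)

/-- A circle as a generator of `V_ρ`. -/
def gen (ρ : Resolution n) (a : D.Circle ρ) : D.V M ρ :=
  ExteriorAlgebra.ι (MarkRing M) (Finsupp.single a 1)

/-- The underlying module of the complex, `⨁_ρ V_ρ`. -/
abbrev Chain : Type _ := (ρ : Resolution n) → D.V M ρ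

/-- The ring map `V_ρ → V_ρ'` that sends each circle of `ρ` to a circle of `ρ'` sharing a point with
it. If `ρ` and `ρ'` differ at one crossing, this circle of `ρ'` is the only such one, except where
a circle `a` of `ρ` is split into `b` and `c`; then `a` goes to one of `b`, `c`. -/
def transfer (ρ ρ' : Resolution n) : D.V M ρ →ₗ[MarkRing M] D.V M ρ' :=
  (ExteriorAlgebra.map
    (Finsupp.lmapDomain (MarkRing M) (MarkRing M)
      (fun a : D.Circle ρ => D.circleOf ρ' (Quot.out a)))).toLinearMap

open Classical in
/-- The map `V_ρ → V_ρ'` of a change of resolution at the crossing `c` (so `ρ` and `ρ'` differ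
exactly at `c`), along an arrow in `ρ`. A join identifies the generators of the two circles. A
split of `a` into `b` and `c` is `π ↦ (b - c) π`, `a π ↦ b c π`, which is `(b - c) ∧ -` applied to
either lift; `b` is the circle through the end `j` and `c` the circle through the end `j + 2`. The
arrow, turned counterclockwise by a right angle, points from `b` to `c`. -/
def surgery (ρ ρ' : Resolution n) (c : Fin n) (j : Fin 4) :
    D.V M ρ →ₗ[MarkRing M] D.V M ρ' :=
  if D.IsSplit ρ c then
    (LinearMap.mulLeft (MarkRing M)
      (D.gen M ρ' (D.circleOf ρ' (Sum.inl (c, j))) -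
        D.gen M ρ' (D.circleOf ρ' (Sum.inl (c, j + 2))))).comp (D.transfer M ρ ρ')
  else D.transfer M ρ ρ'

/-- The naive component `V_ρ → V_ρ'` of the odd Khovanov differential at a crossing `c`, where `ρ'`
is `ρ` with the `1`-resolution in place of the `0`-resolution at `c`. -/
def forward (o : CrossingOrientation n) (c : Fin n) (ρ ρ' : Resolution n) :
    D.V M ρ →ₗ[MarkRing M] D.V M ρ' :=
  D.surgery M ρ ρ' c (arrowTail o c + 1)

/-- The naive map `V_ρ' → V_ρ` in the direction opposite to `forward`, along the arrow that is
obtained by turning the arrow of `c` counterclockwise by a right angle. -/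
def backward (o : CrossingOrientation n) (c : Fin n) (ρ' ρ : Resolution n) :
    D.V M ρ' →ₗ[MarkRing M] D.V M ρ :=
  D.surgery M ρ' ρ c (arrowTail o c + 2)

/-- The differential `d_odd` with signs `ε` on the edges of the cube of resolutions; `ε c ρ`, for
`ρ c = false`, is the sign of the edge from `ρ` in direction `c` (other values are not used). -/
def dOdd (o : CrossingOrientation n) (ε : Fin n → Resolution n → ℤˣ) :
    D.Chain M →ₗ[MarkRing M] D.Chain M :=
  LinearMap.pi fun ρ' => ∑ c, if ρ' c = true then
      (ε c (Function.update ρ' c false) : ℤ) •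
        (D.forward M o c (Function.update ρ' c false) ρ').comp
          (LinearMap.proj (Function.update ρ' c false))
    else 0

end

/-- The face of the cube of resolutions from `ρ` in the directions `c`, `e` is one of those that
both commute and anticommute: at `ρ` both arcs have their ends on a single circle, and a change of
either crossing splits it, after which a change of the other crossing joins the two parts again. -/
def IsBothFace (c e : Fin n) (ρ : Resolution n) : Prop :=
  c ≠ e ∧ ρ c = false ∧ ρ e = false ∧ D.IsSplit ρ c ∧ D.IsSplit ρ e ∧
    ¬ D.IsSplit (Function.update ρ c true) e

/-- For a face as in `IsBothFace`: the oriented configuration is the one (`X`) in which a walk on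
the circle of `ρ` from the tail of the arrow of `c` to its head, in the direction that has this
arrow on the left, meets the tail of the arrow of `e` and not its head. (The part of the circle
covered by this walk is closed up at `c` to the circle of the `1`-resolution of `c` through the end
`arrowTail o c + 1`.) In the other configuration (`Y`) the walk meets the head of the
arrow of `e`. -/
def IsTypeX (o : CrossingOrientation n) (c e : Fin n) (ρ : Resolution n) : Prop :=
  D.circleOf (Function.update ρ c true) (Sum.inl (e, arrowTail o e)) =
    D.circleOf (Function.update ρ c true) (Sum.inl (c, arrowTail o c + 1))

/-- `ε` is a sign assignment on the edges of the cube of resolutions: the corrected differential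
squares to zero, and on the faces that both commute and anticommute the signs are those that turn
naive faces into anticommuting ones when type `X` is counted as anticommuting (so it gets an even
number of minus signs) and type `Y` as commuting (so it gets an odd number of minus signs). -/
structure IsSignAssignment (M : Type*) (o : CrossingOrientation n)
    (ε : Fin n → Resolution n → ℤˣ) : Prop where
  dOdd_comp_dOdd : (D.dOdd M o ε).comp (D.dOdd M o ε) = 0
  typeX : ∀ c e ρ, D.IsBothFace c e ρ → D.IsTypeX o c e ρ →
    ε c ρ * ε e (Function.update ρ c true) * (ε e ρ * ε c (Function.update ρ e true)) = 1
  typeY : ∀ c e ρ, D.IsBothFace c e ρ → ¬ D.IsTypeX o c e ρ →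
    ε c ρ * ε e (Function.update ρ c true) * (ε e ρ * ε c (Function.update ρ e true)) = -1

/-- `s` is a choice of the signs on the vertices of the cube of resolutions that enter `d_v`: the
two ends of a split edge have the same sign, the two ends of a join edge have opposite signs. -/
structure IsVertexSign (s : Resolution n → ℤˣ) : Prop where
  split : ∀ c ρ, ρ c = false → D.IsSplit ρ c → s (Function.update ρ c true) = s ρ
  join : ∀ c ρ, ρ c = false → ¬ D.IsSplit ρ c → s (Function.update ρ c true) = -s ρ

noncomputable section

variable {M : Type*} [Fintype M]

open Classical in
/-- The weight of a circle `a` of `ρ`, the sum of the variables of the marks on `a`. The mark `m`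
lies on the edge named by `μ m`. -/
def weight (μ : M → D.Point) (ρ : Resolution n) (a : D.Circle ρ) : MarkRing M :=
  ∑ m, if D.circleOf ρ (μ m) = a then MvPolynomial.X m else 0

/-- The differential `d_v`: on `V_ρ` it is left multiplication by the sum over the circles `a` of
`ρ` of `(weight of a) a`, with the sign `s ρ`. -/
def dV (μ : M → D.Point) (s : Resolution n → ℤˣ) : D.Chain M →ₗ[MarkRing M] D.Chain M :=
  LinearMap.pi fun ρ => (s ρ : ℤ) •
    (∑ a, LinearMap.mulLeft (MarkRing M) (D.weight μ ρ a • D.gen M ρ a)).comp (LinearMap.proj ρ)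

/-- The differential `d_v + d_odd` of the totally twisted odd Khovanov complex. -/
def dTotal (o : CrossingOrientation n) (μ : M → D.Point) (ε : Fin n → Resolution n → ℤˣ)
    (s : Resolution n → ℤˣ) : D.Chain M →ₗ[MarkRing M] D.Chain M :=
  D.dV μ s + D.dOdd M o ε

/-- The marks `μ'` are obtained from the marks `μ` by sliding the mark `m` under the crossing `c`,
from the edge at the end `i` of the under-strand to the edge at its opposite end. -/
structure SlidesUnder (μ μ' : M → D.Point) (m : M) (c : Fin n) (i : Fin 4) : Prop where
  under : i = 0 ∨ i = 2
  source : D.SameEdge (μ m) (Sum.inl (c, i))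
  target : D.SameEdge (μ' m) (Sum.inl (c, i + 2))
  other : ∀ k, k ≠ m → μ' k = μ k

/-- The part `H` of the isomorphism: for each outer resolution, it maps the summand with the
`1`-resolution at `c` to the summand with the `0`-resolution at `c` by `± x_m` times the
naive backward map. The sign is the product of the sign of the edge of the cube, the
sign of the vertex with the `1`-resolution at `c`, and a sign depending on the arrow of `c` only,
which is `+` if the arrow starts on the strand through the end `i + 2` to which the mark moves. -/
def slideMap (o : CrossingOrientation n) (ε : Fin n → Resolution n → ℤˣ)
    (s : Resolution n → ℤˣ) (m : M) (c : Fin n) (i : Fin 4) :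
    D.Chain M →ₗ[MarkRing M] D.Chain M :=
  LinearMap.pi fun ρ => if ρ c = false then
      ((ε c ρ * s (Function.update ρ c true) * (if arrowTail o c = i then -1 else 1) : ℤˣ) : ℤ) •
        (MvPolynomial.X m : MarkRing M) •
          (D.backward M o c (Function.update ρ c true) ρ).comp
            (LinearMap.proj (Function.update ρ c true))
    else 0

end

end LinkDiagram

end TwistedOdd

open TwistedOdd

/-! Since `H` maps 1-resolutions at `c` to 0-resolutions and vanishes on the latter, `H ^ 2 = 0` and
`id - H` inverts `id + H`. What remains is `(id + H) d = d' (id + H)`. Write `d_c` and `d_e` for the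
parts of `d_odd` at `c` and at another crossing `e`. Sorted by the resolutions of source and target,
the equation splits into four identities: `d_v' = d_v + H d_c` at 0-resolutions of `c`, `d_v = d_v'
+ d_c H` at 1-resolutions, `d_v' H = H d_v` from a 1-resolution to the corresponding 0-resolution,
and `d_e H = H d_e`.

For the first two, a surgery followed by its reverse is, up to sign, multiplication by the
difference of the circles through two opposite ends of `c`; times `x_m`, this is exactly the change
of the weighted sum of circles when the mark slides (`SlidesUnder.backward_forward`,
`SlidesUnder.forward_backward`). The third holds because a surgery at `c` annihilates this
difference (`SlidesUnder.markSum_mul_backward`).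

The fourth is a question of signs on a face of the cube (`toV_backward_forward`). If the two
crossings join the same two circles, both sides vanish. On the faces that both commute and
anticommute, the convention on types `X` and `Y` gives the right sign, by planarity
(`circleOf_bothFace`). On every other face `d_odd ^ 2 = 0` forces the product of the four edge signs
(`faceSign_eq`).

The algebra is done upstairs: each `V_ρ` is a quotient of the exterior algebra on all points of the
diagram, and there a surgery is left multiplication by `1` or by a difference of two points
(`surgery_toV`). The topology rests on the fact that a surgery is a split exactly if its reverse is
a join (`DifferAt.isSplit_iff`). -/

namespace TwistedOdd

/-! ### Circles under a change of one crossing -/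

/-- The resolutions `ρ` and `ρ'` differ at the crossing `c` and nowhere else. -/
def DifferAt {n : ℕ} (c : Fin n) (ρ ρ' : Resolution n) : Prop :=
  ρ' c = !ρ c ∧ ∀ e, e ≠ c → ρ' e = ρ e

lemma DifferAt.symm {n : ℕ} {c : Fin n} {ρ ρ' : Resolution n} (h : DifferAt c ρ ρ') :
    DifferAt c ρ' ρ :=
  ⟨by simp [h.1], fun e he => (h.2 e he).symm⟩

lemma differAt_update {n : ℕ} {c : Fin n} {ρ : Resolution n} {b : Bool} (h : b = !ρ c) :
    DifferAt c ρ (Function.update ρ c b) :=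
  ⟨by simp [h], fun e he => by simp [he]⟩

lemma smoothing_smoothing (b : Bool) (i : Fin 4) : smoothing b (smoothing b i) = i := by
  revert b i; decide

/-- If `f'` arises from `f` by exchanging the values `x` and `y`, then `x` and `y` cannot be on a
common orbit for both maps. -/
lemma not_iterate_swap {α : Type*} [DecidableEq α] (P : α → Prop) (f f' : α → α) {x y : α}
    (hxy : x ≠ y) (hx : P x) (hP : ∀ z, P z → P (f z))
    (hf : ∀ z, P z → f' z = Equiv.swap x y (f z)) (h : ∃ k, f^[k] x = y) :
    ∀ j, f'^[j] x ≠ y := by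
  classical
  obtain ⟨k, hk, hmin⟩ : ∃ k, f^[k] x = y ∧ ∀ i < k, f^[i] x ≠ y :=
    ⟨Nat.find h, Nat.find_spec h, fun i hi => Nat.find_min h hi⟩
  have hk0 : 0 < k := by
    rcases Nat.eq_zero_or_pos k with rfl | h0
    · exact absurd hk hxy
    · exact h0
  have hPi : ∀ i, P (f^[i] x) := by
    intro i
    induction i with
    | zero => exact hx
    | succ i ih => rw [Function.iterate_succ_apply']; exact hP _ ih
  -- With `k` the first time at which `f` takes `x` to `y`, the `f'`-orbit of `x` follows the
  -- `f`-orbit up to time `k - 1`, and then the swap sends it back to `x` instead of `y`. It cannot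
  -- be diverted earlier: a return of `f` to `x` before time `k` would make `y` appear sooner.
  have key : ∀ j, ∃ i < k, f'^[j] x = f^[i] x := by
    intro j
    induction j with
    | zero => exact ⟨0, hk0, rfl⟩
    | succ j ih =>
      obtain ⟨i, hi, e⟩ := ih
      rw [Function.iterate_succ_apply', e, hf _ (hPi i), ← Function.iterate_succ_apply' f]
      rcases Nat.lt_or_ge (i + 1) k with h1 | h1
      · refine ⟨i + 1, h1, Equiv.swap_apply_of_ne_of_ne ?_ (hmin _ h1)⟩
        intro hret
        apply hmin (k - (i + 1)) (by omega)
        rw [← hk]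
        conv_rhs => rw [show k = (k - (i + 1)) + (i + 1) by omega, Function.iterate_add_apply, hret]
      · refine ⟨0, hk0, ?_⟩
        rw [show i.succ = k by omega, hk, Equiv.swap_apply_right]; rfl
  intro j hj
  obtain ⟨i, hi, e⟩ := key j
  exact hmin i hi (e ▸ hj)

namespace LinkDiagram

variable {n l : ℕ} (D : LinkDiagram n l)

lemma circleOf_glue (ρ : Resolution n) (d : Fin n × Fin 4) :
    D.circleOf ρ (Sum.inl (D.glue d)) = D.circleOf ρ (Sum.inl d) :=
  (Quot.sound (Joined.edge d)).symm

lemma circleOf_smoothing (ρ : Resolution n) (c : Fin n) (i : Fin 4) :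
    D.circleOf ρ (Sum.inl (c, smoothing (ρ c) i)) = D.circleOf ρ (Sum.inl (c, i)) :=
  (Quot.sound (Joined.corner c i)).symm

lemma SameEdge.circleOf_eq {D : LinkDiagram n l} {p q : D.Point} (h : D.SameEdge p q)
    (ρ : Resolution n) : D.circleOf ρ p = D.circleOf ρ q := by
  rcases h with rfl | ⟨d, rfl, rfl⟩
  · rfl
  · exact (D.circleOf_glue ρ d).symm

lemma circleOf_of_false {ρ : Resolution n} {c : Fin n} (h : ρ c = false) :
    D.circleOf ρ (Sum.inl (c, 1)) = D.circleOf ρ (Sum.inl (c, 0)) ∧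
      D.circleOf ρ (Sum.inl (c, 3)) = D.circleOf ρ (Sum.inl (c, 2)) := by
  have h0 := D.circleOf_smoothing ρ c 0
  have h2 := D.circleOf_smoothing ρ c 2
  rw [h] at h0 h2
  exact ⟨h0, h2⟩

lemma circleOf_of_true {ρ : Resolution n} {c : Fin n} (h : ρ c = true) :
    D.circleOf ρ (Sum.inl (c, 3)) = D.circleOf ρ (Sum.inl (c, 0)) ∧
      D.circleOf ρ (Sum.inl (c, 1)) = D.circleOf ρ (Sum.inl (c, 2)) := by
  have h0 := D.circleOf_smoothing ρ c 0
  have h2 := D.circleOf_smoothing ρ c 2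
  rw [h] at h0 h2
  exact ⟨h0, h2⟩

/-- Every end at a crossing is on one of the two strands there. -/
lemma circleOf_end (ρ : Resolution n) (c : Fin n) (i : Fin 4) :
    D.circleOf ρ (Sum.inl (c, i)) = D.circleOf ρ (Sum.inl (c, 0)) ∨
      D.circleOf ρ (Sum.inl (c, i)) = D.circleOf ρ (Sum.inl (c, 2)) := by
  cases h : ρ c
  · have := D.circleOf_of_false h
    fin_cases i <;> simp_all
  · have := D.circleOf_of_true h
    fin_cases i <;> simp_all

/-- A change of resolution at `c` only affects the circles through `c`. -/
lemma _root_.TwistedOdd.DifferAt.circleOf_eq_or {D : LinkDiagram n l} {c : Fin n} {ρ ρ' : Resolution n}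
    (h : DifferAt c ρ ρ') {p q : D.Point} (hpq : D.circleOf ρ p = D.circleOf ρ q) :
    D.circleOf ρ' p = D.circleOf ρ' q ∨
      ((D.circleOf ρ' p = D.circleOf ρ' (Sum.inl (c, 0)) ∨
          D.circleOf ρ' p = D.circleOf ρ' (Sum.inl (c, 2))) ∧
        (D.circleOf ρ' q = D.circleOf ρ' (Sum.inl (c, 0)) ∨
          D.circleOf ρ' q = D.circleOf ρ' (Sum.inl (c, 2)))) := by
  have hgen : Relation.EqvGen (D.Joined ρ) p q := Quot.eqvGen_exact hpq
  clear hpq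
  induction hgen with
  | rel p q hr =>
    cases hr with
    | edge d => exact Or.inl (D.circleOf_glue ρ' d).symm
    | corner e i =>
      by_cases he : e = c
      · subst he
        exact Or.inr ⟨D.circleOf_end _ _ _, D.circleOf_end _ _ _⟩
      · left
        rw [← h.2 e he]
        exact (D.circleOf_smoothing ρ' e i).symm
  | refl => exact Or.inl rfl
  | symm p q _ ih => exact ih.imp Eq.symm And.symm
  | trans p q r _ _ ih1 ih2 =>
    rcases ih1 with h1 | ⟨h1, h1'⟩
    · rw [h1]; exact ih2
    · rcases ih2 with h2 | ⟨h2, h2'⟩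
      · rw [← h2]; exact Or.inr ⟨h1, h1'⟩
      · exact Or.inr ⟨h1, h2'⟩

/-! ### Orientations; the reverse of a split is a join and conversely -/

/-- The ends of crossings can be divided into outgoing and incoming ones, such that every edge and
every strand of a resolution is oriented (from checkerboard colouring of the regions). -/
lemma exists_orientation : ∃ κ : Fin n × Fin 4 → Bool,
    (∀ d, κ (D.glue d) = !κ d) ∧ ∀ c i, κ (c, i) = !κ (c, i - 1) := by
  -- All edges together form a mod 2 cycle, because each crossing has four ends. An end counts as
  -- outgoing when the sector on its left has colour 0.
  obtain ⟨colour, h1, h2⟩ := D.planar (fun _ => 1) (fun _ => rfl) (fun _ => by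
    simp only [Finset.sum_const, Finset.card_univ, Fintype.card_fin]; decide)
  have key : ∀ a b : ZMod 2, 1 = a - b → decide (a = 0) = !decide (b = 0) := by decide
  refine ⟨fun d => decide (colour d = 0), fun d => ?_, fun c i => key _ _ (h2 c i)⟩
  have := h1 d.1 d.2
  have e := h2 (D.glue d).1 (D.glue d).2
  rw [← this] at e
  exact key _ _ e

/-- The signed number of ends in a set of edges is zero, where a crossing at which the set
consists of strands of a resolution does not contribute. -/
lemma sum_signed_ends {κ : Fin n × Fin 4 → Bool} (hg : ∀ d, κ (D.glue d) = !κ d)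
    (K : Fin n × Fin 4 → Prop) [DecidablePred K] (hK : ∀ d, K (D.glue d) ↔ K d) :
    ∑ c, ∑ i, (if K (c, i) then (if κ (c, i) then 1 else -1 : ℤ) else 0) = 0 := by
  rw [← Finset.sum_product' Finset.univ Finset.univ
    (fun c i => (if K (c, i) then (if κ (c, i) then 1 else -1 : ℤ) else 0))]
  refine Finset.sum_involution (fun d _ => D.glue d) ?_ ?_ ?_ ?_
  · intro d _
    have h1 := hK d
    have h2 := hg d
    by_cases h : K d <;> cases h' : κ d <;> simp_all
  · intro d _ _
    exact D.glue_ne d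
  · intro d _; simp
  · intro d _; exact D.glue_glue d

/-- Each strand of a smoothing joins an outgoing end to an incoming one, so it contributes zero when
it lies in `K`. -/
lemma sum_signed_ends_at {κ : Fin n × Fin 4 → Bool} (hc : ∀ c i, κ (c, i) = !κ (c, i - 1))
    (K : Fin n × Fin 4 → Prop) [DecidablePred K] (c : Fin n) (b : Bool)
    (hK : ∀ i, K (c, smoothing b i) ↔ K (c, i)) :
    ∑ i, (if K (c, i) then (if κ (c, i) then 1 else -1 : ℤ) else 0) = 0 := by
  have k1 : κ (c, 1) = !κ (c, 0) := hc c 1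
  have k2 : κ (c, 2) = !κ (c, 1) := hc c 2
  have k3 : κ (c, 3) = !κ (c, 2) := hc c 3
  have h0 := hK 0
  have h2 := hK 2
  clear hK hc
  rw [Fin.sum_univ_four]
  cases b
  · simp only [smoothing, Matrix.cons_val] at h0 h2
    by_cases a0 : K (c, 0) <;> by_cases a2 : K (c, 2) <;> cases h' : κ (c, 0) <;> simp_all
  · simp only [smoothing, Matrix.cons_val] at h0 h2
    by_cases a0 : K (c, 0) <;> by_cases a2 : K (c, 2) <;> cases h' : κ (c, 0) <;> simp_all

/-- A change of resolution changes whether the two strands lie on one circle: they cannot be on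
different circles both before and after. -/
lemma _root_.TwistedOdd.DifferAt.isSplit_or {D : LinkDiagram n l} {c : Fin n} {ρ ρ' : Resolution n}
    (h : DifferAt c ρ ρ') : D.IsSplit ρ c ∨ D.IsSplit ρ' c := by
  classical
  wlog hρ : ρ c = false generalizing ρ ρ'
  · exact (this h.symm (by have := h.1; simp_all)).symm
  have hρ' : ρ' c = true := by rw [h.1, hρ]; rfl
  by_contra! hcon
  obtain ⟨n1, n2⟩ := hcon
  obtain ⟨κ, hg, hc⟩ := D.exists_orientation
  -- If the strands at `c` are on different circles both before and after, then `(c, 0)` is the only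
  -- end at `c` that shares both its circles with `(c, 0)`. All other crossings contribute zero, so
  -- the signed count is `±1`, although it has to vanish.
  let K : Fin n × Fin 4 → Prop := fun d =>
    D.circleOf ρ (Sum.inl d) = D.circleOf ρ (Sum.inl (c, 0)) ∧
      D.circleOf ρ' (Sum.inl d) = D.circleOf ρ' (Sum.inl (c, 0))
  have hsum := D.sum_signed_ends hg K (fun d => by simp only [K, circleOf_glue])
  rw [Finset.sum_eq_single c, Fin.sum_univ_four] at hsum
  · have a0 : K (c, 0) := ⟨rfl, rfl⟩
    have a1 : ¬ K (c, 1) := fun a => n2 (a.2.symm.trans (D.circleOf_of_true hρ').2)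
    have a2 : ¬ K (c, 2) := fun a => n2 a.2.symm
    have a3 : ¬ K (c, 3) := fun a => n1 (a.1.symm.trans (D.circleOf_of_false hρ).2)
    rw [if_pos a0, if_neg a1, if_neg a2, if_neg a3] at hsum
    split_ifs at hsum <;> omega
  · intro e _ he
    refine sum_signed_ends_at hc K e (ρ e) fun i => ?_
    have h1 := D.circleOf_smoothing ρ' e i
    rw [h.2 e he] at h1
    simp only [K, circleOf_smoothing, h1]
  · simp

/-- The permutation of ends that walks along an edge and then along a strand of `ρ`. -/
def walk (ρ : Resolution n) : Equiv.Perm (Fin n × Fin 4) :=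
  (Function.Involutive.toPerm D.glue D.glue_glue).trans
    (Function.Involutive.toPerm (fun d => (d.1, smoothing (ρ d.1) d.2))
      (fun d => by simp [smoothing_smoothing]))

lemma walk_apply (ρ : Resolution n) (d : Fin n × Fin 4) :
    D.walk ρ d = ((D.glue d).1, smoothing (ρ (D.glue d).1) (D.glue d).2) := rfl

lemma orientation_smoothing {κ : Fin n × Fin 4 → Bool} (hc : ∀ c i, κ (c, i) = !κ (c, i - 1))
    (b : Bool) (c : Fin n) (i : Fin 4) : κ (c, smoothing b i) = !κ (c, i) := by
  have k1 : κ (c, 1) = !κ (c, 0) := hc c 1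
  have k2 : κ (c, 2) = !κ (c, 1) := hc c 2
  have k3 : κ (c, 3) = !κ (c, 2) := hc c 3
  cases b <;> fin_cases i <;> simp [smoothing, k1, k2, k3]

/-- The outgoing ends on a circle form a single cycle of `walk`: the cycle of the outgoing end of an
edge is unchanged along the edge, and passing a strand of `ρ` moves it by one step of the walk.
Hence it is a function of the circle. -/
lemma sameCycle_walk {κ : Fin n × Fin 4 → Bool} (hg : ∀ d, κ (D.glue d) = !κ d)
    (hc : ∀ c i, κ (c, i) = !κ (c, i - 1)) (ρ : Resolution n) {d d' : Fin n × Fin 4}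
    (hd : κ d = true) (hd' : κ d' = true)
    (h : D.circleOf ρ (Sum.inl d) = D.circleOf ρ (Sum.inl d')) :
    (D.walk ρ).SameCycle d d' := by
  let root : Fin n × Fin 4 → Fin n × Fin 4 := fun d => if κ d then d else D.glue d
  let f : D.Point → Option (Quotient (Equiv.Perm.SameCycle.setoid (D.walk ρ))) :=
    Sum.elim (fun d => some (Quotient.mk _ (root d))) (fun _ => none)
  have hf : ∀ p q, D.Joined ρ p q → f p = f q := by
    intro p q hpq
    cases hpq with
    | edge d =>
      cases hκ : κ d <;> simp [f, root, hg, hκ, D.glue_glue]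
    | corner c i =>
      have hs := orientation_smoothing hc (ρ c) c i
      simp only [f, Sum.elim_inl, Option.some_inj]
      apply Quotient.sound
      change (D.walk ρ).SameCycle _ _
      cases hκ : κ (c, i)
      · simp only [root, hκ, hs, Bool.not_false, if_true, Bool.false_eq_true, if_false]
        refine ⟨1, ?_⟩
        simp [walk_apply, D.glue_glue]
      · simp only [root, hκ, hs, Bool.not_true, if_true, Bool.false_eq_true, if_false]
        refine Equiv.Perm.SameCycle.symm ⟨1, ?_⟩
        simp [walk_apply, D.glue_glue, smoothing_smoothing]
  have := congrArg (Quot.lift f hf) h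
  simp only [circleOf, f, Sum.elim_inl, Option.some_inj, root, hd, hd', if_true] at this
  exact Quotient.exact this

/-- A change of resolution changes whether the two strands lie on one circle: they cannot be on
one circle both before and after. -/
lemma _root_.TwistedOdd.DifferAt.not_isSplit_and {D : LinkDiagram n l} {c : Fin n} {ρ ρ' : Resolution n}
    (h : DifferAt c ρ ρ') (h1 : D.IsSplit ρ c) (h2 : D.IsSplit ρ' c) : False := by
  classical
  obtain ⟨κ, hg, hc⟩ := D.exists_orientation
  have k1 : κ (c, 1) = !κ (c, 0) := hc c 1
  have k2 : κ (c, 2) = !κ (c, 1) := hc c 2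
  have k3 : κ (c, 3) = !κ (c, 2) := hc c 3
  have all : ∀ ρ, D.IsSplit ρ c → ∀ i j,
      D.circleOf ρ (Sum.inl (c, i)) = D.circleOf ρ (Sum.inl (c, j)) := by
    intro ρ hρ i j
    have e : D.circleOf ρ (Sum.inl (c, 0)) = D.circleOf ρ (Sum.inl (c, 2)) := hρ
    rcases D.circleOf_end ρ c i with a | a <;> rcases D.circleOf_end ρ c j with b | b <;>
      simp [a, b, e]
  -- Outgoing and incoming ends alternate around `c`, so the outgoing ones are two opposite ends.
  obtain ⟨a, ha, ha2⟩ : ∃ a : Fin 4, κ (c, a) = true ∧ κ (c, a + 2) = true := by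
    cases h0 : κ (c, 0)
    · exact ⟨1, by simp [k1, h0], by change κ (c, 3) = true; simp [k1, k2, k3, h0]⟩
    · exact ⟨0, h0, by change κ (c, 2) = true; simp [k1, k2, h0]⟩
  have hcyc : ∀ ρ, D.IsSplit ρ c → ∃ k, (D.walk ρ)^[k] (c, a) = (c, a + 2) := by
    intro ρ hρ
    obtain ⟨k, -, hk⟩ := (D.sameCycle_walk hg hc ρ ha ha2 (all ρ hρ _ _)).exists_pow_eq'
    exact ⟨k, by rw [Equiv.Perm.iterate_eq_pow]; exact hk⟩
  obtain ⟨j, hj⟩ := hcyc ρ' h2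
  have hne : ((c, a) : Fin n × Fin 4) ≠ (c, a + 2) := by
    intro e
    exact absurd (Prod.mk.inj e).2 ((by decide : ∀ a : Fin 4, a ≠ a + 2) a)
  -- The two smoothings of `c` differ by the shift by 2. On outgoing ends, the walk of `ρ'` is
  -- therefore the walk of `ρ` followed by the exchange of `(c, a)` and `(c, a + 2)`.
  refine not_iterate_swap (fun d => κ d = true) (D.walk ρ) (D.walk ρ') hne ha ?_ ?_
    (hcyc ρ h1) j hj
  · intro z hz
    rw [walk_apply, orientation_smoothing hc, hg, hz]; rfl
  · intro z hz
    rw [walk_apply, walk_apply]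
    have hk := hg z
    rw [hz] at hk
    set w := D.glue z
    obtain ⟨e, i⟩ := w
    by_cases he : e = c
    · subst he
      have ho := orientation_smoothing hc (ρ e) e i
      rw [hk] at ho
      simp only [h.1]
      have hsm : smoothing (!ρ e) i = smoothing (ρ e) i + 2 := by
        exact (by decide : ∀ (b : Bool) (i : Fin 4), smoothing (!b) i = smoothing b i + 2) _ _
      rw [hsm]
      have : smoothing (ρ e) i = a ∨ smoothing (ρ e) i = a + 2 := by
        generalize smoothing (ρ e) i = i' at ho
        clear hcyc hj hne ha2 hsm all hk
        clear hc
        fin_cases a <;> fin_cases i' <;> simp_all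
      rcases this with e1 | e1 <;> rw [e1]
      · rw [Equiv.swap_apply_left]
      · rw [Equiv.swap_apply_right]
        congr 1
        rw [add_assoc]; exact add_zero a
    · rw [h.2 e he, Equiv.swap_apply_of_ne_of_ne]
      · intro e1; exact he (Prod.mk.inj e1).1
      · intro e1; exact he (Prod.mk.inj e1).1

lemma _root_.TwistedOdd.DifferAt.isSplit_iff {D : LinkDiagram n l} {c : Fin n} {ρ ρ' : Resolution n}
    (h : DifferAt c ρ ρ') : D.IsSplit ρ' c ↔ ¬ D.IsSplit ρ c :=
  ⟨fun h2 h1 => DifferAt.not_isSplit_and h h1 h2, fun h1 => (DifferAt.isSplit_or h).resolve_left h1⟩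

/-- A join keeps points on a common circle together. -/
lemma _root_.TwistedOdd.DifferAt.circleOf_eq {D : LinkDiagram n l} {c : Fin n} {ρ ρ' : Resolution n}
    (h : DifferAt c ρ ρ') (hs : ¬ D.IsSplit ρ c) {p q : D.Point}
    (hpq : D.circleOf ρ p = D.circleOf ρ q) : D.circleOf ρ' p = D.circleOf ρ' q := by
  have e : D.circleOf ρ' (Sum.inl (c, 0)) = D.circleOf ρ' (Sum.inl (c, 2)) :=
    (DifferAt.isSplit_iff h).2 hs
  rcases DifferAt.circleOf_eq_or h hpq with h1 | ⟨h1 | h1, h2 | h2⟩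
  · exact h1
  all_goals simp [h1, h2, e]

/-! ### Sides of a circle in the plane -/

/-- Colour the regions by the side of the circle `A` of `ρ` that they lie on. The colour to the left
of the strands of `ρ` (with respect to `κ`) is constant along the circles of `ρ`. -/
lemma exists_colour {κ : Fin n × Fin 4 → Bool} (hg : ∀ d, κ (D.glue d) = !κ d)
    (hc : ∀ c i, κ (c, i) = !κ (c, i - 1)) (ρ : Resolution n) (A : D.Circle ρ) :
    ∃ colour : Fin n × Fin 4 → ZMod 2,
      (∀ c i, (colour (c, i) = colour (c, i - 1) ↔ D.circleOf ρ (Sum.inl (c, i)) ≠ A)) ∧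
      ∀ c i e j, D.circleOf ρ (Sum.inl (c, i)) = D.circleOf ρ (Sum.inl (e, j)) →
        (if κ (c, i) then colour (c, i) else colour (c, i - 1)) =
          if κ (e, j) then colour (e, j) else colour (e, j - 1) := by
  classical
  let S : Fin n × Fin 4 → ZMod 2 := fun d => if D.circleOf ρ (Sum.inl d) = A then 1 else 0
  have two : ∀ a : ZMod 2, a + a = 0 := by decide
  obtain ⟨colour, h1, h2⟩ := D.planar S (fun d => by simp only [S, circleOf_glue]) (fun c => by
    rw [Fin.sum_univ_four]
    cases h : ρ c
    · have := D.circleOf_of_false h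
      simp only [S, this.1, this.2, two, zero_add]
    · have := D.circleOf_of_true h
      simp only [S, this.1, this.2]
      rw [add_assoc (ite _ _ _), two, add_zero, two])
  refine ⟨colour, fun c i => ?_, ?_⟩
  · have := h2 c i
    simp only [S] at this
    split_ifs at this with hA
    · simp only [hA, ne_eq, not_true_eq_false, iff_false]
      intro e; rw [e, sub_self] at this; exact one_ne_zero this
    · simpa [hA] using (sub_eq_zero.1 this.symm)
  -- The left-hand side in the direction of travel: at an incoming end it is the sector on the right
  -- when looking away from the crossing.
  · let L : D.Point → ZMod 2 :=
      Sum.elim (fun d => if κ d then colour d else colour (d.1, d.2 - 1)) (fun _ => 0)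
    have hL : ∀ p q, D.Joined ρ p q → L p = L q := by
      intro p q hpq
      cases hpq with
      | edge d =>
        have e1 := h1 d.1 d.2
        have e2 := h1 (D.glue d).1 (D.glue d).2
        simp only [Prod.mk.eta, D.glue_glue] at e1 e2
        cases hκ : κ d <;> simp [L, hg, hκ, e1, e2]
      | corner c i =>
        have k1 : κ (c, 1) = !κ (c, 0) := hc c 1
        have k2 : κ (c, 2) = !κ (c, 1) := hc c 2
        have k3 : κ (c, 3) = !κ (c, 2) := hc c 3
        have j0 : S (c, 0) = colour (c, 0) - colour (c, 3) := h2 c 0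
        have j1 : S (c, 1) = colour (c, 1) - colour (c, 0) := h2 c 1
        have j2 : S (c, 2) = colour (c, 2) - colour (c, 1) := h2 c 2
        have j3 : S (c, 3) = colour (c, 3) - colour (c, 2) := h2 c 3
        have add : ∀ x y z : ZMod 2, x - y = y - z → x = z := by decide
        cases h : ρ c
        · have hS : S (c, 1) = S (c, 0) ∧ S (c, 3) = S (c, 2) := by
            have := D.circleOf_of_false h
            simp only [S, this.1, this.2, and_self]
          have q1 := add _ _ _ (j1.symm.trans (hS.1.trans j0))
          clear h1 h2 hc
          cases hκ : κ (c, 0) <;> fin_cases i <;>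
            simp [L, smoothing, k1, k2, k3, hκ, q1, show (0 - 1 : Fin 4) = 3 from rfl,
              show (2 - 1 : Fin 4) = 1 from rfl, show (3 - 1 : Fin 4) = 2 from rfl]
        · have hS : S (c, 3) = S (c, 0) ∧ S (c, 1) = S (c, 2) := by
            have := D.circleOf_of_true h
            simp only [S, this.1, this.2, and_self]
          have q1 := add _ _ _ (j0.symm.trans (hS.1.symm.trans j3))
          clear h1 h2 hc
          cases hκ : κ (c, 0) <;> fin_cases i <;>
            simp [L, smoothing, k1, k2, k3, hκ, q1, show (0 - 1 : Fin 4) = 3 from rfl,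
              show (2 - 1 : Fin 4) = 1 from rfl]
    intro c i e j h
    exact congrArg (Quot.lift L hL) h

/-- Two circles that are both adjacent to the crossings `c` and `e` are traversed there in
compatible directions. This is the place where planarity of the diagram is needed. -/
lemma orientation_eq {κ : Fin n × Fin 4 → Bool} (hg : ∀ d, κ (D.glue d) = !κ d)
    (hc : ∀ c i, κ (c, i) = !κ (c, i - 1)) {ρ : Resolution n} {c e : Fin n}
    (hρc : ρ c = true) (hρe : ρ e = false) {t u : Fin 4} (ht : t = 0 ∨ t = 2) (hu : u = 0 ∨ u = 2)
    (h1 : D.circleOf ρ (Sum.inl (e, u)) = D.circleOf ρ (Sum.inl (c, t + 1)))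
    (h2 : D.circleOf ρ (Sum.inl (e, u + 2)) = D.circleOf ρ (Sum.inl (c, t + 3)))
    (hne : D.circleOf ρ (Sum.inl (c, t + 3)) ≠ D.circleOf ρ (Sum.inl (c, t + 1))) :
    κ (e, u) = κ (c, t + 1) := by
  obtain ⟨col, hcol, hL⟩ := D.exists_colour hg hc ρ (D.circleOf ρ (Sum.inl (c, t + 1)))
  have k : ∀ c, κ (c, 0) = κ (c, 2) ∧ κ (c, 1) = (!κ (c, 2)) ∧ κ (c, 3) = !κ (c, 2) := by
    intro c
    have k1 : κ (c, 1) = !κ (c, 0) := hc c 1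
    have k2 : κ (c, 2) = !κ (c, 1) := hc c 2
    have k3 : κ (c, 3) = !κ (c, 2) := hc c 3
    rw [k2, k1] at *
    simp [k3]
  have hL1 := hL _ _ _ _ h1
  have hL2 := hL _ _ _ _ h2
  have c0 := D.circleOf_of_true hρc
  have e0 := D.circleOf_of_false hρe
  have a0 := hcol c 0
  have a1 := hcol c 1
  have a2 := hcol c 2
  have a3 := hcol c 3
  have b0 := hcol e 0
  have b1 := hcol e 1
  have b2 := hcol e 2
  have b3 := hcol e 3
  have kc := k c
  have ke := k e
  clear hL hcol hc hg k
  simp only [show (0 - 1 : Fin 4) = 3 from rfl, show (1 - 1 : Fin 4) = 0 from rfl,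
    show (2 - 1 : Fin 4) = 1 from rfl, show (3 - 1 : Fin 4) = 2 from rfl] at a0 a1 a2 a3 b0 b1 b2 b3
  have third : ∀ x y z : ZMod 2, x ≠ y → y ≠ z → x = z := by decide
  by_contra hk
  rcases ht with rfl | rfl <;> rcases hu with rfl | rfl <;>
    simp only [show (0 + 1 : Fin 4) = 1 from rfl, show (2 + 1 : Fin 4) = 3 from rfl,
      show (0 + 2 : Fin 4) = 2 from rfl, show (2 + 2 : Fin 4) = 0 from rfl,
      show (0 + 3 : Fin 4) = 3 from rfl, show (2 + 3 : Fin 4) = 1 from rfl,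
      show (0 - 1 : Fin 4) = 3 from rfl, show (1 - 1 : Fin 4) = 0 from rfl,
      show (2 - 1 : Fin 4) = 1 from rfl, show (3 - 1 : Fin 4) = 2 from rfl] at * <;>
    cases hkc : κ (c, 2) <;> cases hke : κ (e, 2) <;> simp_all

lemma _root_.TwistedOdd.DifferAt.isSplit_of_join {D : LinkDiagram n l} {c : Fin n} {ρ ρ' : Resolution n}
    (h : DifferAt c ρ ρ') (hs : ¬ D.IsSplit ρ c) {e : Fin n} (he : D.IsSplit ρ e) :
    D.IsSplit ρ' e :=
  DifferAt.circleOf_eq h hs he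

/-- The ends `j` and `j + 2` of a crossing are on the two different strands. -/
lemma circleOf_opposite (ρ : Resolution n) (c : Fin n) (j : Fin 4) :
    (D.circleOf ρ (Sum.inl (c, j)) = D.circleOf ρ (Sum.inl (c, 0)) ∧
        D.circleOf ρ (Sum.inl (c, j + 2)) = D.circleOf ρ (Sum.inl (c, 2))) ∨
      (D.circleOf ρ (Sum.inl (c, j)) = D.circleOf ρ (Sum.inl (c, 2)) ∧
        D.circleOf ρ (Sum.inl (c, j + 2)) = D.circleOf ρ (Sum.inl (c, 0))) := by
  cases h : ρ c
  · have := D.circleOf_of_false h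
    fin_cases j <;> simp_all
  · have := D.circleOf_of_true h
    fin_cases j <;> simp_all

/-! ### Surgeries lifted to the exterior algebra on points -/

section

variable (M : Type*)

/-- The exterior algebra on the points of the diagram. -/
abbrev PointAlgebra : Type _ := ExteriorAlgebra (MarkRing M) (D.Point →₀ MarkRing M)

/-- A point as a generator. -/
noncomputable def pt (p : D.Point) : D.PointAlgebra M :=
  ExteriorAlgebra.ι (MarkRing M) (Finsupp.single p 1)

/-- The map of exterior algebras that sends a point to the circle of `ρ` through it. -/
noncomputable def toV (ρ : Resolution n) : D.PointAlgebra M →ₐ[MarkRing M] D.V M ρ :=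
  ExteriorAlgebra.map (Finsupp.lmapDomain (MarkRing M) (MarkRing M) (D.circleOf ρ))

variable {M}

lemma toV_pt (ρ : Resolution n) (p : D.Point) :
    D.toV M ρ (D.pt M p) = D.gen M ρ (D.circleOf ρ p) := by
  simp [toV, pt, gen, ExteriorAlgebra.map_apply_ι, Finsupp.lmapDomain_apply,
    Finsupp.mapDomain_single]

lemma toV_surjective (ρ : Resolution n) : Function.Surjective (D.toV M ρ) := by
  rw [toV, ExteriorAlgebra.map_surjective_iff]
  exact Finsupp.mapDomain_surjective Quot.mk_surjective

/-- Two maps of exterior algebras agree after multiplication with a vector `w`, if this holds on the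
generators. -/
lemma ι_mul_map_eq {R N N' : Type*} [CommRing R] [AddCommGroup N] [Module R N] [AddCommGroup N']
    [Module R N'] {f g : N →ₗ[R] N'} {w : N'}
    (h : ∀ v, ExteriorAlgebra.ι R w * ExteriorAlgebra.ι R (f v) =
      ExteriorAlgebra.ι R w * ExteriorAlgebra.ι R (g v)) (x : ExteriorAlgebra R N) :
    ExteriorAlgebra.ι R w * ExteriorAlgebra.map f x =
      ExteriorAlgebra.ι R w * ExteriorAlgebra.map g x := by
  have swap : ∀ v : N', ExteriorAlgebra.ι R w * ExteriorAlgebra.ι R v =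
      -(ExteriorAlgebra.ι R v * ExteriorAlgebra.ι R w) := fun v =>
    eq_neg_of_add_eq_zero_left (ExteriorAlgebra.ι_add_mul_swap w v)
  induction x using CliffordAlgebra.left_induction with
  | algebraMap r =>
    have e : ∀ f : N →ₗ[R] N', ExteriorAlgebra.map f (algebraMap R (ExteriorAlgebra R N) r) =
        algebraMap R _ r := fun f => AlgHom.commutes _ _
    exact congrArg _ ((e f).trans (e g).symm)
  | add x y hx hy => rw [map_add, map_add, mul_add, mul_add, hx, hy]
  | ι_mul x v hx =>
    change ExteriorAlgebra.ι R w * ExteriorAlgebra.map f (ExteriorAlgebra.ι R v * x) =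
      ExteriorAlgebra.ι R w * ExteriorAlgebra.map g (ExteriorAlgebra.ι R v * x)
    rw [map_mul, map_mul, ExteriorAlgebra.map_apply_ι, ExteriorAlgebra.map_apply_ι, ← mul_assoc,
      ← mul_assoc, h, swap, neg_mul, neg_mul, mul_assoc, mul_assoc, hx]

open Classical in
/-- The factor by which a change of resolution at `c` multiplies, when computed with points. -/
noncomputable def cut (M : Type*) (ρ : Resolution n) (c : Fin n) (j : Fin 4) : D.PointAlgebra M :=
  if D.IsSplit ρ c then D.pt M (Sum.inl (c, j)) - D.pt M (Sum.inl (c, j + 2)) else 1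

lemma cut_of_isSplit {ρ : Resolution n} {c : Fin n} (h : D.IsSplit ρ c) (j : Fin 4) :
    D.cut M ρ c j = D.pt M (Sum.inl (c, j)) - D.pt M (Sum.inl (c, j + 2)) := if_pos h

lemma cut_of_not_isSplit {ρ : Resolution n} {c : Fin n} (h : ¬ D.IsSplit ρ c) (j : Fin 4) :
    D.cut M ρ c j = 1 := if_neg h

lemma transfer_toV (ρ ρ' : Resolution n) (x : D.PointAlgebra M) :
    D.transfer M ρ ρ' (D.toV M ρ x) =
      ExteriorAlgebra.map (Finsupp.lmapDomain (MarkRing M) (MarkRing M)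
        (fun p => D.circleOf ρ' (Quot.out (D.circleOf ρ p)))) x := by
  rw [transfer, toV, AlgHom.toLinearMap_apply, ← AlgHom.comp_apply, ExteriorAlgebra.map_comp_map,
    ← Finsupp.lmapDomain_comp]
  rfl

/-- This removes the arbitrary representatives in `transfer`: when `a` and `b` arise by a split, `(a
- b) ∧ a = (a - b) ∧ b`, so either lift gives the same result, and a join leaves no choice.
Composites of surgeries become products in an algebra that does not depend on the resolution. -/
lemma surgery_toV {c : Fin n} {ρ ρ' : Resolution n} (h : DifferAt c ρ ρ') (j : Fin 4)
    (x : D.PointAlgebra M) :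
    D.surgery M ρ ρ' c j (D.toV M ρ x) = D.toV M ρ' (D.cut M ρ c j * x) := by
  have hout : ∀ p, D.circleOf ρ (Quot.out (D.circleOf ρ p)) = D.circleOf ρ p :=
    fun p => Quot.out_eq _
  by_cases hs : D.IsSplit ρ c
  · rw [surgery, if_pos hs, cut_of_isSplit D hs, LinearMap.comp_apply, LinearMap.mulLeft_apply,
      transfer_toV, map_mul, map_sub, toV_pt, toV_pt, gen, gen, ← map_sub, toV]
    apply ι_mul_map_eq
    set a := D.circleOf ρ' (Sum.inl (c, 0)) with ha
    set b := D.circleOf ρ' (Sum.inl (c, 2)) with hb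
    set w := Finsupp.single (D.circleOf ρ' (Sum.inl (c, j))) (1 : MarkRing M) -
      Finsupp.single (D.circleOf ρ' (Sum.inl (c, j + 2))) 1 with hw
    have hab : ExteriorAlgebra.ι (MarkRing M) w *
        ExteriorAlgebra.ι (MarkRing M) (Finsupp.single a 1) =
        ExteriorAlgebra.ι (MarkRing M) w *
          ExteriorAlgebra.ι (MarkRing M) (Finsupp.single b 1) := by
      rw [← sub_eq_zero, ← mul_sub, ← map_sub]
      rcases D.circleOf_opposite ρ' c j with ⟨e1, e2⟩ | ⟨e1, e2⟩
      · rw [hw, e1, e2, ExteriorAlgebra.ι_sq_zero]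
      · rw [hw, e1, e2, ← neg_sub (Finsupp.single a _), map_neg, neg_mul,
          ExteriorAlgebra.ι_sq_zero, neg_zero]
    intro v
    induction v using Finsupp.induction_linear with
    | zero => simp
    | add v v' hv hv' => rw [map_add, map_add, map_add, map_add, mul_add, mul_add, hv, hv']
    | single p r =>
      rw [Finsupp.lmapDomain_apply, Finsupp.mapDomain_single, Finsupp.lmapDomain_apply,
        Finsupp.mapDomain_single, ← Finsupp.smul_single_one, ← Finsupp.smul_single_one _ r, map_smul, map_smul, mul_smul_comm, mul_smul_comm]
      congr 1
      rcases DifferAt.circleOf_eq_or h (hout p) with h1 | ⟨h1 | h1, h2 | h2⟩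
      · rw [h1]
      all_goals rw [h1, h2]
      · exact hab
      · exact hab.symm
  · rw [surgery, if_neg hs, cut_of_not_isSplit D hs, one_mul, transfer_toV, toV]
    congr 3
    funext p
    exact DifferAt.circleOf_eq h hs (hout p)

end

lemma _root_.TwistedOdd.DifferAt.eq_update {c : Fin n} {ρ ρ' : Resolution n}
    (h : DifferAt c ρ ρ') : ρ' = Function.update ρ c (ρ' c) := by
  funext e
  by_cases he : e = c
  · subst he; simp
  · simp [he, h.2 e he]

/-! ### The differentials square to zero -/

section

variable {M : Type*}

/-- After a join the opposite ends lie on one circle and their difference vanishes; after a split it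
is, up to sign, the factor of the surgery itself, whose square is zero. Hence the position of the
sliding mark is invisible after a surgery at `c`. -/
lemma toV_opposite_mul_cut {c : Fin n} {ρ ρ' : Resolution n} (h : DifferAt c ρ ρ') (i j : Fin 4) :
    D.toV M ρ' ((D.pt M (Sum.inl (c, i)) - D.pt M (Sum.inl (c, i + 2))) * D.cut M ρ c j) = 0 := by
  have sq : ∀ x y : D.Circle ρ', (D.gen M ρ' x - D.gen M ρ' y) *
      (D.gen M ρ' x - D.gen M ρ' y) = 0 := by
    intro x y
    rw [gen, gen, ← map_sub, ExteriorAlgebra.ι_sq_zero]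
  by_cases hs : D.IsSplit ρ c
  · rw [cut_of_isSplit D hs, map_mul, map_sub, map_sub, toV_pt, toV_pt, toV_pt, toV_pt]
    rcases D.circleOf_opposite ρ' c i with ⟨e1, e2⟩ | ⟨e1, e2⟩ <;>
    rcases D.circleOf_opposite ρ' c j with ⟨e3, e4⟩ | ⟨e3, e4⟩ <;> rw [e1, e2, e3, e4]
    · exact sq _ _
    · rw [← neg_sub, neg_mul, sq, neg_zero]
    · rw [← neg_sub, neg_mul, sq, neg_zero]
    · exact sq _ _
  · have e : D.circleOf ρ' (Sum.inl (c, 0)) = D.circleOf ρ' (Sum.inl (c, 2)) :=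
      (DifferAt.isSplit_iff h).2 hs
    rw [cut_of_not_isSplit D hs, mul_one, map_sub, toV_pt, toV_pt, sub_eq_zero]
    rcases D.circleOf_opposite ρ' c i with ⟨e1, e2⟩ | ⟨e1, e2⟩ <;> rw [e1, e2, e]

lemma dOdd_apply (o : CrossingOrientation n) (ε : Fin n → Resolution n → ℤˣ) (x : D.Chain M)
    (ρ : Resolution n) :
    D.dOdd M o ε x ρ = ∑ c, if ρ c = true then (ε c (Function.update ρ c false) : ℤ) •
      D.forward M o c (Function.update ρ c false) ρ (x (Function.update ρ c false)) else 0 := by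
  rw [dOdd, LinearMap.pi_apply, LinearMap.sum_apply]
  refine Finset.sum_congr rfl fun c _ => ?_
  split_ifs <;> rfl

variable [Fintype M]

/-- The sum of the marks, as points weighted by their variables. -/
noncomputable def markSum (μ : M → D.Point) : D.PointAlgebra M :=
  ExteriorAlgebra.ι (MarkRing M) (∑ m, Finsupp.single (μ m) (MvPolynomial.X m))

lemma markSum_eq (μ : M → D.Point) :
    D.markSum μ = ∑ m, (MvPolynomial.X m : MarkRing M) • D.pt M (μ m) := by
  simp only [markSum, map_sum, pt, ← map_smul, Finsupp.smul_single, smul_eq_mul, mul_one]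

lemma dV_apply (μ : M → D.Point) (s : Resolution n → ℤˣ) (x : D.Chain M) (ρ : Resolution n) :
    D.dV μ s x ρ = (s ρ : ℤ) • (D.toV M ρ (D.markSum μ) * x ρ) := by
  classical
  have e : ∑ a, D.weight μ ρ a • D.gen M ρ a = D.toV M ρ (D.markSum μ) := by
    simp only [markSum_eq, map_sum, map_smul, toV_pt, weight, Finset.sum_smul]
    rw [Finset.sum_comm]
    refine Finset.sum_congr rfl fun m _ => ?_
    simp [ite_smul]
  rw [← e, Finset.sum_mul]
  simp [dV]

lemma dV_comp_dV (μ : M → D.Point) (s : Resolution n → ℤˣ) :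
    (D.dV μ s).comp (D.dV μ s) = 0 := by
  refine LinearMap.ext fun x => funext fun ρ => ?_
  rw [LinearMap.comp_apply, dV_apply, dV_apply, mul_smul_comm, ← mul_assoc, ← map_mul, markSum,
    ExteriorAlgebra.ι_sq_zero]
  simp

lemma IsVertexSign.eq {D : LinkDiagram n l} {s : Resolution n → ℤˣ} (hs : D.IsVertexSign s)
    {c : Fin n} {ρ ρ' : Resolution n} (h : DifferAt c ρ ρ') (h0 : ρ c = false) :
    (D.IsSplit ρ c → s ρ' = s ρ) ∧ (¬ D.IsSplit ρ c → s ρ' = -s ρ) := by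
  have e := h.eq_update
  rw [h.1, h0] at e
  rw [e]
  exact ⟨hs.split c ρ h0, hs.join c ρ h0⟩

lemma markSum_mul_cut (μ : M → D.Point) {ρ : Resolution n} {c : Fin n} (h : D.IsSplit ρ c)
    (j : Fin 4) : D.markSum μ * D.cut M ρ c j = -(D.cut M ρ c j * D.markSum μ) := by
  rw [cut_of_isSplit D h, markSum, pt, pt, ← map_sub]
  exact eq_neg_of_add_eq_zero_left (ExteriorAlgebra.ι_add_mul_swap _ _)

/-- Multiplication with the marks anticommutes with a surgery, with the signs of the vertices. -/
lemma markSum_mul_surgery (μ : M → D.Point) {s s' : ℤˣ} {c : Fin n} {ρ ρ' : Resolution n}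
    (h : DifferAt c ρ ρ') (h1 : D.IsSplit ρ c → s' = s) (h2 : ¬ D.IsSplit ρ c → s' = -s)
    (j : Fin 4) (y : D.V M ρ) :
    (s' : ℤ) • (D.toV M ρ' (D.markSum μ) * D.surgery M ρ ρ' c j y) +
      (s : ℤ) • D.surgery M ρ ρ' c j (D.toV M ρ (D.markSum μ) * y) = 0 := by
  obtain ⟨x, rfl⟩ := D.toV_surjective ρ y
  rw [← map_mul, surgery_toV D h, surgery_toV D h, ← map_mul]
  by_cases hs : D.IsSplit ρ c
  · rw [h1 hs, ← smul_add, ← map_add, ← mul_assoc, markSum_mul_cut D μ hs, neg_mul, mul_assoc,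
      neg_add_cancel, map_zero, smul_zero]
  · rw [h2 hs, cut_of_not_isSplit D hs, one_mul, one_mul, Units.val_neg, neg_smul, neg_add_cancel]

lemma dV_dOdd_anticomm (o : CrossingOrientation n) (μ : M → D.Point)
    (ε : Fin n → Resolution n → ℤˣ) {s : Resolution n → ℤˣ} (hs : D.IsVertexSign s) :
    (D.dV μ s).comp (D.dOdd M o ε) + (D.dOdd M o ε).comp (D.dV μ s) = 0 := by
  refine LinearMap.ext fun x => funext fun ρ => ?_
  simp only [LinearMap.add_apply, LinearMap.comp_apply, Pi.add_apply]
  rw [dV_apply, dOdd_apply, dOdd_apply, Finset.mul_sum, Finset.smul_sum, ← Finset.sum_add_distrib]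
  refine Finset.sum_eq_zero fun c _ => ?_
  split_ifs with hρ
  · have hd : DifferAt c (Function.update ρ c false) ρ :=
      (differAt_update (by rw [hρ]; rfl)).symm
    have h := IsVertexSign.eq hs hd (by simp)
    have key := D.markSum_mul_surgery μ hd h.1 h.2 (arrowTail o c + 1)
      (x (Function.update ρ c false))
    rw [dV_apply, forward, mul_smul_comm, smul_comm, map_zsmul, ← smul_add, key, smul_zero]
  · simp

lemma dTotal_comp_dTotal (o : CrossingOrientation n) (μ : M → D.Point)
    {ε : Fin n → Resolution n → ℤˣ} (hε : (D.dOdd M o ε).comp (D.dOdd M o ε) = 0)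
    {s : Resolution n → ℤˣ} (hs : D.IsVertexSign s) :
    (D.dTotal o μ ε s).comp (D.dTotal o μ ε s) = 0 := by
  rw [dTotal, LinearMap.add_comp, LinearMap.comp_add, LinearMap.comp_add, dV_comp_dV, hε, zero_add,
    add_zero]
  exact D.dV_dOdd_anticomm o μ ε hs

end

end LinkDiagram
end TwistedOdd

/-! ### Topology of the faces of the cube of resolutions -/

namespace TwistedOdd

/-- Four resolutions that form a face of the cube of resolutions in the directions `c` and `e`. -/
structure IsFace {n : ℕ} (c e : Fin n) (ρ₀₀ ρ₁₀ ρ₀₁ ρ₁₁ : Resolution n) : Prop where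
  ne : c ≠ e
  left : ρ₀₀ c = false
  right : ρ₀₀ e = false
  c₀ : DifferAt c ρ₀₀ ρ₁₀
  c₁ : DifferAt c ρ₀₁ ρ₁₁
  e₀ : DifferAt e ρ₀₀ ρ₀₁
  e₁ : DifferAt e ρ₁₀ ρ₁₁

namespace IsFace

variable {n : ℕ} {c e : Fin n} {ρ₀₀ ρ₁₀ ρ₀₁ ρ₁₁ : Resolution n}

lemma values (h : IsFace c e ρ₀₀ ρ₁₀ ρ₀₁ ρ₁₁) :
    (ρ₁₀ c = true ∧ ρ₁₀ e = false) ∧ (ρ₀₁ c = false ∧ ρ₀₁ e = true) ∧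
      (ρ₁₁ c = true ∧ ρ₁₁ e = true) := by
  have h1 : ρ₁₀ c = true := by rw [h.c₀.1, h.left]; rfl
  have h2 : ρ₁₀ e = false := by rw [h.c₀.2 e h.ne.symm, h.right]
  have h3 : ρ₀₁ c = false := by rw [h.e₀.2 c h.ne, h.left]
  have h4 : ρ₀₁ e = true := by rw [h.e₀.1, h.right]; rfl
  have h5 : ρ₁₁ c = true := by rw [h.c₁.1, h3]; rfl
  have h6 : ρ₁₁ e = true := by rw [h.e₁.1, h2]; rfl
  exact ⟨⟨h1, h2⟩, ⟨h3, h4⟩, ⟨h5, h6⟩⟩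

end IsFace

namespace LinkDiagram

variable {n l : ℕ} (D : LinkDiagram n l)

section topology

variable {c e : Fin n} {ρ₀₀ ρ₁₀ ρ₀₁ ρ₁₁ : Resolution n}

/-- A join never separates strands that share a circle. This is applied to the surgery at `e` and to
the reverse of the one at `c`. -/
lemma isSplit_face_of_split_join {D : LinkDiagram n l} (h : IsFace c e ρ₀₀ ρ₁₀ ρ₀₁ ρ₁₁)
    (hc : D.IsSplit ρ₀₀ c) (he : ¬ D.IsSplit ρ₀₀ e) : ¬ D.IsSplit ρ₁₀ e ∧ D.IsSplit ρ₀₁ c :=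
  ⟨fun h' => he (h.c₀.symm.isSplit_of_join (fun h'' => (DifferAt.isSplit_iff h.c₀).1 h'' hc) h'),
    h.e₀.isSplit_of_join he hc⟩

lemma isSplit_face_of_join_split {D : LinkDiagram n l} (h : IsFace c e ρ₀₀ ρ₁₀ ρ₀₁ ρ₁₁)
    (hc : ¬ D.IsSplit ρ₀₀ c) (he : D.IsSplit ρ₀₀ e) : D.IsSplit ρ₁₀ e ∧ ¬ D.IsSplit ρ₀₁ c :=
  ⟨h.c₀.isSplit_of_join hc he,
    fun h' => hc (h.e₀.symm.isSplit_of_join (fun h'' => (DifferAt.isSplit_iff h.e₀).1 h'' he) h')⟩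

/-- The number of circles changes equally along both paths to `ρ₁₁`. Instead of counting, the proof
uses that a join keeps the strands at the other crossing together. -/
lemma isSplit_face_iff {D : LinkDiagram n l} (h : IsFace c e ρ₀₀ ρ₁₀ ρ₀₁ ρ₁₁)
    (hce : D.IsSplit ρ₀₀ c ↔ D.IsSplit ρ₀₀ e) : D.IsSplit ρ₁₀ e ↔ D.IsSplit ρ₀₁ c := by
  have f1 := DifferAt.isSplit_iff (D := D) h.e₁
  have f2 := DifferAt.isSplit_iff (D := D) h.c₁
  have f3 := DifferAt.isSplit_iff (D := D) h.e₀
  have f4 := DifferAt.isSplit_iff (D := D) h.c₀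
  have j1 := h.c₁.symm.isSplit_of_join (D := D) (e := e)
  have j2 := h.c₁.isSplit_of_join (D := D) (e := e)
  have j3 := h.e₁.symm.isSplit_of_join (D := D) (e := c)
  have j4 := h.e₁.isSplit_of_join (D := D) (e := c)
  tauto

/-- The position of the strands on a face as in `IsBothFace`. -/
lemma circleOf_bothFace {D : LinkDiagram n l} (h : IsFace c e ρ₀₀ ρ₁₀ ρ₀₁ ρ₁₁)
    (hc : D.IsSplit ρ₀₀ c) (he : D.IsSplit ρ₀₀ e) (he' : ¬ D.IsSplit ρ₁₀ e)
    (hc' : ¬ D.IsSplit ρ₀₁ c) {t u : Fin 4} (ht : t = 0 ∨ t = 2) (hu : u = 0 ∨ u = 2)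
    (hX : D.circleOf ρ₁₀ (Sum.inl (e, u)) = D.circleOf ρ₁₀ (Sum.inl (c, t + 1))) :
    D.circleOf ρ₀₁ (Sum.inl (e, u + 1)) = D.circleOf ρ₀₁ (Sum.inl (c, t)) ∧
      D.circleOf ρ₀₁ (Sum.inl (e, u + 3)) = D.circleOf ρ₀₁ (Sum.inl (c, t + 2)) := by
  classical
  obtain ⟨⟨v1, v2⟩, ⟨v3, v4⟩, -⟩ := h.values
  have n1 : ¬ D.IsSplit ρ₁₀ c := fun h' => (DifferAt.isSplit_iff h.c₀).1 h' hc
  have n2 : ¬ D.IsSplit ρ₀₁ e := fun h' => (DifferAt.isSplit_iff h.e₀).1 h' he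
  have m1 := (DifferAt.circleOf_eq_or h.c₀ he).resolve_left he'
  have m2 := (DifferAt.circleOf_eq_or h.e₀ hc).resolve_left hc'
  have w1 := D.circleOf_of_true v1
  have w2 := D.circleOf_of_false v2
  have w3 := D.circleOf_of_false v3
  have w4 := D.circleOf_of_true v4
  obtain ⟨κ, hg, hκ⟩ := D.exists_orientation
  have a1 : D.circleOf ρ₁₀ (Sum.inl (e, u + 2)) = D.circleOf ρ₁₀ (Sum.inl (c, t + 3)) ∧
      D.circleOf ρ₁₀ (Sum.inl (c, t)) = D.circleOf ρ₁₀ (Sum.inl (c, t + 3)) ∧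
      D.circleOf ρ₁₀ (Sum.inl (e, u + 3)) = D.circleOf ρ₁₀ (Sum.inl (e, u + 2)) ∧
      D.circleOf ρ₁₀ (Sum.inl (c, t + 3)) ≠ D.circleOf ρ₁₀ (Sum.inl (c, t + 1)) := by
    clear m2 w3 w4 n2 hc hc' he hκ hg
    simp only [IsSplit] at *
    rcases ht with rfl | rfl <;> rcases hu with rfl | rfl <;>
    simp only [show (0 + 1 : Fin 4) = 1 from rfl, show (2 + 1 : Fin 4) = 3 from rfl,
      show (0 + 2 : Fin 4) = 2 from rfl, show (2 + 2 : Fin 4) = 0 from rfl,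
      show (0 + 3 : Fin 4) = 3 from rfl, show (2 + 3 : Fin 4) = 1 from rfl] at * <;>
    grind
  obtain ⟨a1, a2, a3, a4⟩ := a1
  have hor := D.orientation_eq hg hκ v1 v2 ht hu hX a1 a4
  by_contra hcon
  -- The strands at `e` can only be matched with those at `c` in two ways; this is the one to be
  -- excluded.
  have b1 : D.circleOf ρ₀₁ (Sum.inl (e, u + 1)) = D.circleOf ρ₀₁ (Sum.inl (c, t + 2)) ∧
      D.circleOf ρ₀₁ (Sum.inl (c, t + 1)) = D.circleOf ρ₀₁ (Sum.inl (c, t)) ∧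
      D.circleOf ρ₀₁ (Sum.inl (e, u)) = D.circleOf ρ₀₁ (Sum.inl (c, t)) ∧
      D.circleOf ρ₀₁ (Sum.inl (c, t + 2)) ≠ D.circleOf ρ₀₁ (Sum.inl (c, t)) := by
    clear m1 w1 w2 n1 hc he' he hκ hg hor a1 a2 a3 a4 hX
    simp only [IsSplit] at *
    rcases ht with rfl | rfl <;> rcases hu with rfl | rfl <;>
    simp only [show (0 + 1 : Fin 4) = 1 from rfl, show (2 + 1 : Fin 4) = 3 from rfl,
      show (0 + 2 : Fin 4) = 2 from rfl, show (2 + 2 : Fin 4) = 0 from rfl,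
      show (0 + 3 : Fin 4) = 3 from rfl, show (2 + 3 : Fin 4) = 1 from rfl] at * <;>
    grind
  obtain ⟨b1, b2, b3, b4⟩ := b1
  -- In the excluded position, the ends at `c` and `e` that share both circles with `(c, t + 1)` are
  -- just `(c, t + 1)` and `(e, u)`. By `orientation_eq` they have equal signs, so the signed count
  -- is `±2` and not zero.
  let K : Fin n × Fin 4 → Prop := fun d =>
    D.circleOf ρ₁₀ (Sum.inl d) = D.circleOf ρ₁₀ (Sum.inl (c, t + 1)) ∧
      D.circleOf ρ₀₁ (Sum.inl d) = D.circleOf ρ₀₁ (Sum.inl (c, t + 1))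
  have hsum := D.sum_signed_ends hg K (fun d => by simp only [K, circleOf_glue])
  have four : ∀ (t : Fin 4) (f : Fin 4 → ℤ), ∑ i, f i = f t + f (t + 1) + f (t + 2) + f (t + 3) := by
    intro t f
    rw [← Equiv.sum_comp (Equiv.addLeft t), Fin.sum_univ_four]
    simp
  rw [Finset.sum_eq_add c e h.ne, four t, four u] at hsum
  · have kc0 : ¬ K (c, t) := fun k => a4 (a2.symm.trans k.1)
    have kc1 : K (c, t + 1) := ⟨rfl, rfl⟩
    have kc2 : ¬ K (c, t + 2) := fun k => b4 (k.2.trans b2)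
    have kc3 : ¬ K (c, t + 3) := fun k => a4 k.1
    have ke0 : K (e, u) := ⟨hX, b3.trans b2.symm⟩
    have ke1 : ¬ K (e, u + 1) := fun k => b4 (b1.symm.trans (k.2.trans b2))
    have ke2 : ¬ K (e, u + 2) := fun k => a4 (a1.symm.trans k.1)
    have ke3 : ¬ K (e, u + 3) := fun k => a4 (a1.symm.trans (a3.symm.trans k.1))
    rw [if_neg kc0, if_pos kc1, if_neg kc2, if_neg kc3, if_pos ke0, if_neg ke1, if_neg ke2,
      if_neg ke3, hor] at hsum
    split_ifs at hsum <;> omega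
  · intro f _ hf
    refine sum_signed_ends_at hκ K f (ρ₀₀ f) fun i => ?_
    have h1 := D.circleOf_smoothing ρ₁₀ f i
    have h2 := D.circleOf_smoothing ρ₀₁ f i
    rw [h.c₀.2 f hf.1] at h1
    rw [h.e₀.2 f hf.2] at h2
    simp only [K, h1, h2]
  · simp
  · simp

end topology

/-! ### Nonvanishing in the exterior algebra -/

section independence

variable {M : Type*}

lemma eq_zero_of_smul_gen_sub {ρ : Resolution n} {a b : D.Circle ρ} (hab : a ≠ b) {r : ℤ}
    (h : r • (D.gen M ρ a - D.gen M ρ b) = 0) : r = 0 := by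
  rw [gen, gen, ← map_sub, ← map_zsmul, ExteriorAlgebra.ι_eq_zero_iff] at h
  have := DFunLike.congr_fun h a
  simpa [Finsupp.single_apply, hab.symm] using this

/-- Contraction with the coordinate of `a` turns the product of `v = a - a'` and `r w`, where `w = b
- b'`, into `r w - (r w)(a) v`. The coefficient at whichever of `b`, `b'` is neither `a` nor `a'` is
`±r`. -/
lemma eq_zero_of_smul_gen_sub_mul {ρ : Resolution n} {a a' b b' : D.Circle ρ} (ha : a ≠ a')
    (hb : b ≠ b') (hab : (b ≠ a ∧ b ≠ a') ∨ (b' ≠ a ∧ b' ≠ a')) {r : ℤ}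
    (h : r • ((D.gen M ρ a - D.gen M ρ a') * (D.gen M ρ b - D.gen M ρ b')) = 0) : r = 0 := by
  rw [gen, gen, gen, gen, ← map_sub, ← map_sub, ← mul_smul_comm, ← map_zsmul] at h
  set v : D.Circle ρ →₀ MarkRing M := Finsupp.single a 1 - Finsupp.single a' 1 with hv
  set w : D.Circle ρ →₀ MarkRing M := Finsupp.single b 1 - Finsupp.single b' 1 with hw
  have h2 := congrArg (CliffordAlgebra.contractLeft (Q := 0) (Finsupp.lapply a)) h
  have h3 : v a • ExteriorAlgebra.ι (MarkRing M) (r • w) -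
      ExteriorAlgebra.ι (MarkRing M) v * algebraMap _ _ ((r • w) a) = 0 := by
    rw [map_zero] at h2
    rw [← h2]
    refine Eq.symm ((CliffordAlgebra.contractLeft_ι_mul _ _ _).trans ?_)
    rw [show ExteriorAlgebra.ι (MarkRing M) (r • w) = CliffordAlgebra.ι 0 (r • w) from rfl,
      CliffordAlgebra.contractLeft_ι]
    rfl
  rw [← Algebra.commutes, ← Algebra.smul_def, ← map_smul, ← map_smul, ← map_sub,
    ExteriorAlgebra.ι_eq_zero_iff] at h3
  have hva : v a = 1 := by simp [hv, ha.symm]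
  rw [hva, one_smul] at h3
  rcases hab with ⟨h4, h5⟩ | ⟨h4, h5⟩
  · have := DFunLike.congr_fun h3 b
    simpa [hv, hw, Finsupp.single_apply, h4.symm, h5.symm, hb.symm] using this
  · have := DFunLike.congr_fun h3 b'
    simpa [hv, hw, Finsupp.single_apply, h4.symm, h5.symm, hb] using this

end independence

end LinkDiagram
end TwistedOdd

/-! ### Signs of faces, and backward maps against forward maps -/

namespace TwistedOdd
namespace LinkDiagram

variable {n l : ℕ} (D : LinkDiagram n l) {M : Type*}

lemma arrowTail_eq (o : CrossingOrientation n) (c : Fin n) :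
    arrowTail o c = 0 ∨ arrowTail o c = 2 := by
  unfold arrowTail; split_ifs <;> simp

section

variable {c e : Fin n} {ρ₀₀ ρ₁₀ ρ₀₁ ρ₁₁ : Resolution n}

lemma dOdd_single (o : CrossingOrientation n) (ε : Fin n → Resolution n → ℤˣ) {c : Fin n}
    {ρ ρ' : Resolution n} (h : DifferAt c ρ ρ') (h0 : ρ c = false) (y : D.V M ρ) :
    D.dOdd M o ε (Pi.single ρ y) ρ' = (ε c ρ : ℤ) • D.forward M o c ρ ρ' y := by
  have h1 : ρ' c = true := by rw [h.1, h0]; rfl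
  have hu : Function.update ρ' c false = ρ := by rw [← h0]; exact h.symm.eq_update.symm
  rw [dOdd_apply, Finset.sum_eq_single c]
  · rw [if_pos h1, hu, Pi.single_eq_same]
  · intro f _ hf
    split_ifs
    · rw [Pi.single_eq_of_ne, map_zero, smul_zero]
      intro he
      have := congrFun he c
      rw [Function.update_of_ne hf.symm, h0, h1] at this
      cases this
    · rfl
  · simp

lemma dOdd_single_eq_zero (o : CrossingOrientation n) (ε : Fin n → Resolution n → ℤˣ)
    {c e : Fin n} (hce : c ≠ e) {ρ ρ' : Resolution n} (hc : ρ c = false) (he : ρ e = false)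
    (hc' : ρ' c = true) (he' : ρ' e = true) (y : D.V M ρ) :
    D.dOdd M o ε (Pi.single ρ y) ρ' = 0 := by
  rw [dOdd_apply]
  refine Finset.sum_eq_zero fun f _ => ?_
  split_ifs
  · rw [Pi.single_eq_of_ne, map_zero, smul_zero]
    intro h
    by_cases hf : f = c
    · have := congrFun h e
      rw [Function.update_of_ne (by rw [hf]; exact hce.symm), he, he'] at this
      cases this
    · have := congrFun h c
      rw [Function.update_of_ne (Ne.symm hf), hc, hc'] at this
      cases this
  · rfl

/-- A face of the cube of resolutions anticommutes. -/
lemma forward_face (o : CrossingOrientation n) {ε : Fin n → Resolution n → ℤˣ}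
    (hε : (D.dOdd M o ε).comp (D.dOdd M o ε) = 0) (h : IsFace c e ρ₀₀ ρ₁₀ ρ₀₁ ρ₁₁)
    (y : D.V M ρ₀₀) :
    (ε e ρ₁₀ * ε c ρ₀₀ : ℤ) • D.forward M o e ρ₁₀ ρ₁₁ (D.forward M o c ρ₀₀ ρ₁₀ y) +
      (ε c ρ₀₁ * ε e ρ₀₀ : ℤ) • D.forward M o c ρ₀₁ ρ₁₁ (D.forward M o e ρ₀₀ ρ₀₁ y) = 0 := by
  obtain ⟨⟨v1, v2⟩, ⟨v3, v4⟩, v5, v6⟩ := h.values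
  have hc : Function.update ρ₁₁ c false = ρ₀₁ := by rw [← v3]; exact h.c₁.symm.eq_update.symm
  have he : Function.update ρ₁₁ e false = ρ₁₀ := by rw [← v2]; exact h.e₁.symm.eq_update.symm
  -- A chain supported at `ρ₀₀` reaches `ρ₁₁` in two steps only along the two paths of the face.
  have key := congrFun (LinearMap.congr_fun hε (Pi.single ρ₀₀ y)) ρ₁₁
  rw [LinearMap.comp_apply, dOdd_apply, Finset.sum_eq_add c e h.ne] at key
  · rw [if_pos v5, if_pos v6, hc, he, dOdd_single D o ε h.e₀ h.right,
      dOdd_single D o ε h.c₀ h.left, map_zsmul, map_zsmul, smul_smul, smul_smul] at key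
    rw [add_comm]; exact key
  · intro f _ hf
    split_ifs
    · rw [dOdd_single_eq_zero D o ε h.ne h.left h.right, map_zero, smul_zero]
      · rw [Function.update_of_ne hf.1.symm, v5]
      · rw [Function.update_of_ne hf.2.symm, v6]
    · rfl
  · simp
  · simp

lemma forward_toV {c : Fin n} {ρ ρ' : Resolution n} (h : DifferAt c ρ ρ')
    (o : CrossingOrientation n) (x : D.PointAlgebra M) :
    D.forward M o c ρ ρ' (D.toV M ρ x) = D.toV M ρ' (D.cut M ρ c (arrowTail o c + 1) * x) :=
  surgery_toV D h _ x

lemma backward_toV {c : Fin n} {ρ ρ' : Resolution n} (h : DifferAt c ρ ρ')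
    (o : CrossingOrientation n) (x : D.PointAlgebra M) :
    D.backward M o c ρ ρ' (D.toV M ρ x) = D.toV M ρ' (D.cut M ρ c (arrowTail o c + 2) * x) :=
  surgery_toV D h _ x

/-- The product of the four signs of a face. -/
def faceSign (ε : Fin n → Resolution n → ℤˣ) (c e : Fin n) (ρ₀₀ ρ₁₀ ρ₀₁ : Resolution n) : ℤˣ :=
  ε c ρ₀₀ * ε e ρ₁₀ * (ε e ρ₀₀ * ε c ρ₀₁)

/-- Evaluating the face at `1` leaves only the factors of the surgeries, from which the sign of the
face can be read off wherever they do not vanish. -/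
lemma toV_face (o : CrossingOrientation n) {ε : Fin n → Resolution n → ℤˣ}
    (hε : (D.dOdd M o ε).comp (D.dOdd M o ε) = 0) (h : IsFace c e ρ₀₀ ρ₁₀ ρ₀₁ ρ₁₁) :
    D.toV M ρ₁₁ (D.cut M ρ₁₀ e (arrowTail o e + 1) * D.cut M ρ₀₀ c (arrowTail o c + 1)) +
      (faceSign ε c e ρ₀₀ ρ₁₀ ρ₀₁ : ℤ) •
        D.toV M ρ₁₁ (D.cut M ρ₀₁ c (arrowTail o c + 1) * D.cut M ρ₀₀ e (arrowTail o e + 1)) =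
      0 := by
  have key := D.forward_face o hε h (D.toV M ρ₀₀ 1)
  rw [forward_toV D h.c₀, forward_toV D h.e₁, forward_toV D h.e₀, forward_toV D h.c₁, mul_one,
    mul_one] at key
  have key2 := congrArg (fun z => ((ε e ρ₁₀ * ε c ρ₀₀ : ℤˣ) : ℤ) • z) key
  simp only [smul_add, smul_smul, smul_zero] at key2
  rw [← key2]
  congr 1
  · rw [← Units.val_mul, ← Units.val_mul, ← sq, Int.units_sq, Units.val_one, one_smul]
  · congr 1
    simp only [faceSign, Units.val_mul]
    ring

lemma units_eq_neg_one_of_one_add {a : ℤˣ} (h : (1 + a : ℤ) = 0) : a = -1 := by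
  rcases Int.units_eq_one_or a with rfl | rfl
  · simp at h
  · rfl

lemma units_eq_one_of_one_sub {a : ℤˣ} (h : (1 - a : ℤ) = 0) : a = 1 := by
  rcases Int.units_eq_one_or a with rfl | rfl
  · rfl
  · simp at h

lemma cut_mul_cut_anticomm {ρ ρ' : Resolution n} {c e : Fin n} (hc : D.IsSplit ρ c)
    (he : D.IsSplit ρ' e) (j k : Fin 4) :
    D.cut M ρ c j * D.cut M ρ' e k = -(D.cut M ρ' e k * D.cut M ρ c j) := by
  rw [cut_of_isSplit D hc, cut_of_isSplit D he, pt, pt, pt, pt, ← map_sub, ← map_sub]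
  exact eq_neg_of_add_eq_zero_left (ExteriorAlgebra.ι_add_mul_swap _ _)

lemma cut_eq_of_iff {ρ ρ' : Resolution n} {c : Fin n} (h : D.IsSplit ρ c ↔ D.IsSplit ρ' c)
    (j : Fin 4) : D.cut M ρ c j = D.cut M ρ' c j := by
  by_cases h' : D.IsSplit ρ c
  · rw [cut_of_isSplit D h', cut_of_isSplit D (h.1 h')]
  · rw [cut_of_not_isSplit D h', cut_of_not_isSplit D (fun h'' => h' (h.2 h''))]

lemma circleOf_ne_of_not_isSplit {ρ : Resolution n} {c : Fin n} (h : ¬ D.IsSplit ρ c)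
    (j : Fin 4) : D.circleOf ρ (Sum.inl (c, j)) ≠ D.circleOf ρ (Sum.inl (c, j + 2)) := by
  rcases D.circleOf_opposite ρ c j with ⟨e1, e2⟩ | ⟨e1, e2⟩ <;> rw [e1, e2]
  · exact h
  · exact Ne.symm h

lemma toV_sub_of_isSplit {ρ : Resolution n} {c : Fin n} (h : D.IsSplit ρ c) (j k : Fin 4) :
    D.toV M ρ (D.pt M (Sum.inl (c, j)) - D.pt M (Sum.inl (c, k))) = 0 := by
  have e : D.circleOf ρ (Sum.inl (c, 0)) = D.circleOf ρ (Sum.inl (c, 2)) := h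
  rw [map_sub, toV_pt, toV_pt, sub_eq_zero]
  rcases D.circleOf_end ρ c j with a | a <;> rcases D.circleOf_end ρ c k with b | b <;>
    simp only [a, b, e]

/-- The sign of a face that is not as in `IsBothFace`, unless its two crossings join the same two
circles. -/
lemma faceSign_eq (o : CrossingOrientation n) {ε : Fin n → Resolution n → ℤˣ}
    (hε : (D.dOdd M o ε).comp (D.dOdd M o ε) = 0) (h : IsFace c e ρ₀₀ ρ₁₀ ρ₀₁ ρ₁₁)
    (hb : D.IsSplit ρ₀₀ e ↔ D.IsSplit ρ₁₀ e) (hb' : D.IsSplit ρ₀₀ c ↔ D.IsSplit ρ₀₁ c) :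
    (D.IsSplit ρ₀₀ c ∧ D.IsSplit ρ₀₀ e → faceSign ε c e ρ₀₀ ρ₁₀ ρ₀₁ = 1) ∧
      (¬ (D.IsSplit ρ₀₀ c ∧ D.IsSplit ρ₀₀ e) → faceSign ε c e ρ₀₀ ρ₁₀ ρ₀₁ = -1) := by
  have key := D.toV_face o hε h
  -- Now both paths have the same two factors in opposite orders. These anticommute if both are
  -- splits and commute otherwise; the product is nonzero, which fixes the sign.
  rw [← cut_eq_of_iff D hb, ← cut_eq_of_iff D hb'] at key
  set P := faceSign ε c e ρ₀₀ ρ₁₀ ρ₀₁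
  have hc1 := DifferAt.isSplit_iff (D := D) h.c₁
  have he1 := DifferAt.isSplit_iff (D := D) h.e₁
  by_cases hc : D.IsSplit ρ₀₀ c <;> by_cases he : D.IsSplit ρ₀₀ e
  · refine ⟨fun _ => units_eq_one_of_one_sub ?_, fun h' => absurd ⟨hc, he⟩ h'⟩
    rw [cut_mul_cut_anticomm D hc he, map_neg, smul_neg, ← sub_eq_add_neg] at key
    have nc : ¬ D.IsSplit ρ₁₁ c := fun h' => hc1.1 h' (hb'.1 hc)
    have ne : ¬ D.IsSplit ρ₁₁ e := fun h' => he1.1 h' (hb.1 he)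
    have nc' : ¬ D.IsSplit ρ₁₀ c := fun h' => (DifferAt.isSplit_iff h.c₀).1 h' hc
    have hcirc := fun p q => h.e₁.symm.circleOf_eq (D := D) ne (p := p) (q := q)
    have se : D.circleOf ρ₁₀ (Sum.inl (e, 0)) = D.circleOf ρ₁₀ (Sum.inl (e, 2)) := hb.1 he
    have all : ∀ j, D.circleOf ρ₁₀ (Sum.inl (e, j)) = D.circleOf ρ₁₀ (Sum.inl (e, 0)) := by
      intro j
      rcases D.circleOf_end ρ₁₀ e j with a | a
      · exact a
      · exact a.trans se.symm
    rw [cut_of_isSplit D hc, cut_of_isSplit D he, map_mul, map_sub, map_sub, toV_pt, toV_pt,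
      toV_pt, toV_pt] at key
    refine D.eq_zero_of_smul_gen_sub_mul (circleOf_ne_of_not_isSplit D ne (arrowTail o e + 1))
      (circleOf_ne_of_not_isSplit D nc (arrowTail o c + 1)) ?_ (r := 1 - P)
      (by rw [sub_smul, one_smul]; exact key)
    -- Otherwise both strands of `c` at `ρ₁₁` would lie on the two circles at `e`. Reversing the
    -- surgery at `e` joins these, so the strands of `c` would share a circle at `ρ₁₀`, where they
    -- do not.
    by_contra! hcon
    have two : ∀ p : D.Point, (D.circleOf ρ₁₁ p ≠ D.circleOf ρ₁₁ (Sum.inl (e, arrowTail o e + 1)) →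
        D.circleOf ρ₁₁ p = D.circleOf ρ₁₁ (Sum.inl (e, arrowTail o e + 1 + 2))) →
        D.circleOf ρ₁₀ p = D.circleOf ρ₁₀ (Sum.inl (e, 0)) := by
      intro p hp
      by_cases hp' : D.circleOf ρ₁₁ p = D.circleOf ρ₁₁ (Sum.inl (e, arrowTail o e + 1))
      · exact (hcirc _ _ hp').trans (all _)
      · exact (hcirc _ _ (hp hp')).trans (all _)
    exact circleOf_ne_of_not_isSplit D nc' (arrowTail o c + 1)
      ((two _ hcon.1).trans (two _ hcon.2).symm)
  · refine ⟨fun h' => absurd h'.2 he, fun _ => units_eq_neg_one_of_one_add ?_⟩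
    have nc : ¬ D.IsSplit ρ₁₁ c := fun h' => hc1.1 h' (hb'.1 hc)
    rw [cut_of_isSplit D hc, cut_of_not_isSplit D he, one_mul, mul_one, map_sub, toV_pt,
      toV_pt] at key
    exact D.eq_zero_of_smul_gen_sub (circleOf_ne_of_not_isSplit D nc (arrowTail o c + 1))
      (by rw [add_smul, one_smul]; exact key)
  · refine ⟨fun h' => absurd h'.1 hc, fun _ => units_eq_neg_one_of_one_add ?_⟩
    have ne : ¬ D.IsSplit ρ₁₁ e := fun h' => he1.1 h' (hb.1 he)
    rw [cut_of_isSplit D he, cut_of_not_isSplit D hc, one_mul, mul_one, map_sub, toV_pt,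
      toV_pt] at key
    exact D.eq_zero_of_smul_gen_sub (circleOf_ne_of_not_isSplit D ne (arrowTail o e + 1))
      (by rw [add_smul, one_smul]; exact key)
  · refine ⟨fun h' => absurd h'.1 hc, fun _ => units_eq_neg_one_of_one_add ?_⟩
    rw [cut_of_not_isSplit D he, cut_of_not_isSplit D hc, one_mul, map_one] at key
    have key2 : ((1 + P : ℤ)) • (1 : D.V M ρ₁₁) = 0 := by rw [add_smul, one_smul]; exact key
    rw [← Int.cast_smul_eq_zsmul (MarkRing M), ← Algebra.algebraMap_eq_smul_one,
      ExteriorAlgebra.algebraMap_eq_zero_iff] at key2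
    exact_mod_cast key2

/-- The naive backward map at `c` against the naive forward map at `e`. -/
lemma toV_backward_forward (o : CrossingOrientation n) {ε : Fin n → Resolution n → ℤˣ}
    (hε : D.IsSignAssignment M o ε) {s : Resolution n → ℤˣ} (hs : D.IsVertexSign s)
    (h : IsFace c e ρ₀₀ ρ₁₀ ρ₀₁ ρ₁₁) :
    D.toV M ρ₀₁ (D.cut M ρ₀₀ e (arrowTail o e + 1) * D.cut M ρ₁₀ c (arrowTail o c + 2)) =
      ((faceSign ε c e ρ₀₀ ρ₁₀ ρ₀₁ * (s ρ₁₀ * s ρ₁₁) : ℤˣ) : ℤ) •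
        D.toV M ρ₀₁
          (D.cut M ρ₁₁ c (arrowTail o c + 2) * D.cut M ρ₁₀ e (arrowTail o e + 1)) := by
  have hc0 := DifferAt.isSplit_iff (D := D) h.c₀
  have hc1 := DifferAt.isSplit_iff (D := D) h.c₁
  have he0 := DifferAt.isSplit_iff (D := D) h.e₀
  obtain ⟨⟨v1, v2⟩, -, -⟩ := h.values
  have hsig := IsVertexSign.eq hs h.e₁ v2
  have sq : ∀ a : ℤˣ, a * a = 1 := fun a => by rw [← sq, Int.units_sq]
  have hP := fun hb hb' => D.faceSign_eq o hε.dOdd_comp_dOdd h hb hb'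
  by_cases hc : D.IsSplit ρ₀₀ c <;> by_cases he : D.IsSplit ρ₀₀ e
  · have hiff := isSplit_face_iff h (iff_of_true hc he)
    have nc : ¬ D.IsSplit ρ₁₀ c := fun h' => hc0.1 h' hc
    rw [cut_of_not_isSplit D nc, mul_one]
    by_cases he' : D.IsSplit ρ₁₀ e
    · have nc' : ¬ D.IsSplit ρ₁₁ c := fun h' => hc1.1 h' (hiff.1 he')
      rw [hsig.1 he', sq, mul_one,
        (hP (iff_of_true he he') (iff_of_true hc (hiff.1 he'))).1 ⟨hc, he⟩, Units.val_one, one_smul,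
        cut_of_not_isSplit D nc', one_mul, cut_eq_of_iff D (iff_of_true he he')]
    · have hc' : ¬ D.IsSplit ρ₀₁ c := fun h' => he' (hiff.2 h')
      have e1 : ρ₁₀ = Function.update ρ₀₀ c true := by rw [← v1]; exact h.c₀.eq_update
      have e2 : ρ₀₁ = Function.update ρ₀₀ e true := by
        rw [← h.values.2.1.2]; exact h.e₀.eq_update
      have hboth : D.IsBothFace c e ρ₀₀ := ⟨h.ne, h.left, h.right, hc, he, by rw [← e1]; exact he'⟩
      have hX := hε.typeX c e ρ₀₀ hboth
      have hY := hε.typeY c e ρ₀₀ hboth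
      rw [IsTypeX, ← e1, ← e2] at hX hY
      change _ → faceSign ε c e ρ₀₀ ρ₁₀ ρ₀₁ = 1 at hX
      change _ → faceSign ε c e ρ₀₀ ρ₁₀ ρ₀₁ = -1 at hY
      -- A face that both commutes and anticommutes: both sides are differences of the same two
      -- circles of `ρ₀₁`, named by the ends of `e` on the left and of `c` on the right. The
      -- differences are opposite for type `X` and equal for type `Y`; the vertex signs contribute
      -- `-1` and the face sign makes up the rest.
      rw [hsig.2 he', mul_neg, sq, cut_of_isSplit D (hc1.2 hc'), cut_of_not_isSplit D he', mul_one,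
        cut_of_isSplit D he]
      have ht := arrowTail_eq o c
      have hu := arrowTail_eq o e
      generalize arrowTail o c = t at *
      generalize arrowTail o e = u at *
      have add4 : ∀ i : Fin 4, i + 2 + 2 = i ∧ i + 2 + 1 = i + 3 ∧ i + 1 + 2 = i + 3 ∧
          i + 2 + 3 = i + 1 := by decide
      rw [(add4 t).1, (add4 u).2.2.1]
      simp only [map_sub, toV_pt]
      by_cases hT : D.circleOf ρ₁₀ (Sum.inl (e, u)) = D.circleOf ρ₁₀ (Sum.inl (c, t + 1))
      · obtain ⟨a, b⟩ := circleOf_bothFace h hc he he' hc' ht hu hT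
        rw [hX hT, a, b]
        simp
      · have hT' : D.circleOf ρ₁₀ (Sum.inl (e, u + 2)) = D.circleOf ρ₁₀ (Sum.inl (c, t + 1)) := by
          have m := (DifferAt.circleOf_eq_or h.c₀ he).resolve_left he'
          have o1 := D.circleOf_opposite ρ₁₀ e u
          have o2 := D.circleOf_opposite ρ₁₀ c (t + 1)
          have ne : D.circleOf ρ₁₀ (Sum.inl (e, 0)) ≠ D.circleOf ρ₁₀ (Sum.inl (e, 2)) := he'
          grind
        obtain ⟨a, b⟩ := circleOf_bothFace h hc he he' hc' ht
          (u := u + 2) (by rcases hu with rfl | rfl <;> decide) hT'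
        rw [(add4 u).2.1] at a
        rw [(add4 u).2.2.2] at b
        rw [hY hT, a, b]
        simp
  · obtain ⟨he', hc'⟩ := isSplit_face_of_split_join h hc he
    have nc : ¬ D.IsSplit ρ₁₀ c := fun h' => hc0.1 h' hc
    have nc' : ¬ D.IsSplit ρ₁₁ c := fun h' => hc1.1 h' hc'
    rw [hsig.2 he', mul_neg, sq, (hP (iff_of_false he he') (iff_of_true hc hc')).2 (fun h' => he h'.2),
      cut_of_not_isSplit D nc, cut_of_not_isSplit D nc', cut_of_not_isSplit D he,
      cut_of_not_isSplit D he']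
    simp
  · obtain ⟨he', hc'⟩ := isSplit_face_of_join_split h hc he
    rw [hsig.1 he', sq, (hP (iff_of_true he he') (iff_of_false hc hc')).2 (fun h' => hc h'.1),
      cut_mul_cut_anticomm D he (hc0.2 hc), cut_eq_of_iff D (iff_of_true he he'),
      cut_eq_of_iff D (iff_of_true (hc0.2 hc) (hc1.2 hc'))]
    simp
  · have hiff := isSplit_face_iff h (iff_of_false hc he)
    rw [cut_of_not_isSplit D he, cut_of_isSplit D (hc0.2 hc), one_mul]
    by_cases he' : D.IsSplit ρ₁₀ e
    -- The crossings join the same two circles. At `ρ₀₁` the strands of `c` share a circle, and so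
    -- do those of `e`, so both differences vanish and the sign of the face is irrelevant.
    · have hc' := hiff.1 he'
      have nc' : ¬ D.IsSplit ρ₁₁ c := fun h' => hc1.1 h' hc'
      rw [cut_of_not_isSplit D nc', cut_of_isSplit D he', one_mul,
        toV_sub_of_isSplit D hc', toV_sub_of_isSplit D (he0.2 he), smul_zero]
    · have hc' : ¬ D.IsSplit ρ₀₁ c := fun h' => he' (hiff.2 h')
      rw [hsig.2 he', mul_neg, sq,
        (hP (iff_of_false he he') (iff_of_false hc hc')).2 (fun h' => hc h'.1),
        cut_of_not_isSplit D he', cut_of_isSplit D (hc1.2 hc'), mul_one]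
      simp

end

end LinkDiagram
end TwistedOdd

/-! ### The slide of a mark -/

namespace TwistedOdd
namespace LinkDiagram

variable {n l : ℕ} {D : LinkDiagram n l} {M : Type*}

/-- The sign of the slide, depending on the arrow. -/
def slideSign (o : CrossingOrientation n) (c : Fin n) (i : Fin 4) : ℤˣ :=
  if arrowTail o c = i then -1 else 1

lemma slideMap_apply (o : CrossingOrientation n) (ε : Fin n → Resolution n → ℤˣ)
    (s : Resolution n → ℤˣ) (m : M) (c : Fin n) (i : Fin 4) (x : D.Chain M) (ρ : Resolution n) :
    D.slideMap o ε s m c i x ρ = if ρ c = false then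
      ((ε c ρ * s (Function.update ρ c true) * slideSign o c i : ℤˣ) : ℤ) •
        (MvPolynomial.X m : MarkRing M) •
          D.backward M o c (Function.update ρ c true) ρ (x (Function.update ρ c true)) else 0 := by
  rw [slideMap, LinearMap.pi_apply]
  by_cases h : ρ c = false
  · rw [if_pos h, if_pos h]; rfl
  · rw [if_neg h, if_neg h]; rfl

/-- The part of the differential at another crossing `e` commutes with the slide. -/
lemma slide_face {c e : Fin n} {ρ₀₀ ρ₁₀ ρ₀₁ ρ₁₁ : Resolution n} (o : CrossingOrientation n)
    {ε : Fin n → Resolution n → ℤˣ} (hε : D.IsSignAssignment M o ε) {s : Resolution n → ℤˣ}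
    (hs : D.IsVertexSign s) (h : IsFace c e ρ₀₀ ρ₁₀ ρ₀₁ ρ₁₁) (y : D.V M ρ₁₀) :
    (ε e ρ₀₀ * (ε c ρ₀₀ * s ρ₁₀) : ℤ) • D.forward M o e ρ₀₀ ρ₀₁ (D.backward M o c ρ₁₀ ρ₀₀ y) =
      (ε c ρ₀₁ * s ρ₁₁ * ε e ρ₁₀ : ℤ) •
        D.backward M o c ρ₁₁ ρ₀₁ (D.forward M o e ρ₁₀ ρ₁₁ y) := by
  obtain ⟨x, rfl⟩ := D.toV_surjective ρ₁₀ y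
  rw [backward_toV D h.c₀.symm, forward_toV D h.e₀, forward_toV D h.e₁, backward_toV D h.c₁.symm,
    ← mul_assoc (D.cut M ρ₀₀ _ _), ← mul_assoc (D.cut M ρ₁₁ _ _),
    map_mul (D.toV M ρ₀₁) (D.cut M ρ₀₀ _ _ * _) x, map_mul (D.toV M ρ₀₁) (D.cut M ρ₁₁ _ _ * _) x, D.toV_backward_forward o hε hs h, smul_mul_assoc, smul_smul]
  congr 1
  simp only [← Units.val_mul]
  congr 1
  rw [faceSign]
  calc _ = (ε e ρ₀₀ * ε e ρ₀₀) * (ε c ρ₀₀ * ε c ρ₀₀) * (s ρ₁₀ * s ρ₁₀) *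
        (ε c ρ₀₁ * s ρ₁₁ * ε e ρ₁₀) := by
        simp only [mul_comm, mul_left_comm]
    _ = _ := by simp only [← sq, Int.units_sq, one_mul]

lemma slideMap_comp_slideMap (o : CrossingOrientation n) (ε : Fin n → Resolution n → ℤˣ)
    (s : Resolution n → ℤˣ) (m : M) (c : Fin n) (i : Fin 4) (x : D.Chain M) :
    D.slideMap o ε s m c i (D.slideMap o ε s m c i x) = 0 := by
  funext ρ
  rw [slideMap_apply, slideMap_apply]
  simp

variable [Fintype M]

lemma SlidesUnder.toV_markSum {μ μ' : M → D.Point} {m : M} {c : Fin n} {i : Fin 4}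
    (h : D.SlidesUnder μ μ' m c i) (ρ : Resolution n) :
    D.toV M ρ (D.markSum μ') = D.toV M ρ (D.markSum μ) + (MvPolynomial.X m : MarkRing M) •
      D.toV M ρ (D.pt M (Sum.inl (c, i + 2)) - D.pt M (Sum.inl (c, i))) := by
  classical
  rw [← sub_eq_iff_eq_add', ← map_sub, markSum_eq, markSum_eq, ← Finset.sum_sub_distrib, map_sum,
    Finset.sum_eq_single m]
  · rw [← smul_sub, map_smul, map_sub, map_sub, toV_pt, toV_pt, toV_pt, toV_pt,
      h.source.circleOf_eq, h.target.circleOf_eq]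
  · intro k _ hk
    rw [h.other k hk, sub_self, map_zero]
  · simp

/-- The identity `d_v' = d_v + H d_c`, the edge sign having cancelled. If `c` splits, all its ends
share a circle and the correction vanishes on both sides. If `c` joins, the backward split supplies
the difference of the two circles, and the minus sign from `s` at a join matches the choice of `η`.
-/
lemma SlidesUnder.backward_forward {μ μ' : M → D.Point} {m : M} {c : Fin n} {i : Fin 4}
    (h : D.SlidesUnder μ μ' m c i) (o : CrossingOrientation n) {s : Resolution n → ℤˣ}
    (hs : D.IsVertexSign s) {ρ ρ' : Resolution n} (hd : DifferAt c ρ ρ') (h0 : ρ c = false)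
    (y : D.V M ρ) :
    (s ρ : ℤ) • (D.toV M ρ (D.markSum μ') * y) = (s ρ : ℤ) • (D.toV M ρ (D.markSum μ) * y) +
      (slideSign o c i * s ρ' : ℤ) • (MvPolynomial.X m : MarkRing M) •
        D.backward M o c ρ' ρ (D.forward M o c ρ ρ' y) := by
  obtain ⟨x, rfl⟩ := D.toV_surjective ρ y
  rw [forward_toV D hd, backward_toV D hd.symm, h.toV_markSum, add_mul, smul_add, smul_mul_assoc]
  congr 1
  have hsig := IsVertexSign.eq hs hd h0
  have hiff := hd.isSplit_iff (D := D)
  have ht := arrowTail_eq o c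
  by_cases hsp : D.IsSplit ρ c
  · rw [cut_of_isSplit D hsp, cut_of_not_isSplit D (fun h' => hiff.1 h' hsp), one_mul]
    rw [toV_sub_of_isSplit D hsp, map_mul, toV_sub_of_isSplit D hsp]
    simp
  · rw [hsig.2 hsp, cut_of_not_isSplit D hsp, cut_of_isSplit D (hiff.2 hsp), one_mul, map_mul]
    have e : D.toV M ρ (D.pt M (Sum.inl (c, i + 2)) - D.pt M (Sum.inl (c, i))) =
        -((slideSign o c i : ℤ) • D.toV M ρ (D.pt M (Sum.inl (c, arrowTail o c + 2)) -
          D.pt M (Sum.inl (c, arrowTail o c + 2 + 2)))) := by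
      unfold slideSign
      rcases h.under with rfl | rfl <;> rcases ht with ht | ht <;> rw [ht] <;>
        simp [show (2 + 2 : Fin 4) = 0 from rfl]
    rw [e]
    simp only [neg_mul, smul_neg, smul_mul_assoc, Units.val_neg, mul_neg, neg_smul]
    rw [smul_comm (MvPolynomial.X m : MarkRing M) (slideSign o c i : ℤ), smul_smul, mul_comm]

/-- The identity `d_v = d_v' + d_c H`. The forward split names its circles by ends of the
over-strand; the 1-resolution joins each of them to an end of the under-strand, with the sign `η`
again. -/
lemma SlidesUnder.forward_backward {μ μ' : M → D.Point} {m : M} {c : Fin n} {i : Fin 4}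
    (h : D.SlidesUnder μ μ' m c i) (o : CrossingOrientation n) {s : Resolution n → ℤˣ}
    {ρ ρ' : Resolution n} (hd : DifferAt c ρ ρ') (h0 : ρ c = false) (y : D.V M ρ') :
    (s ρ' : ℤ) • (D.toV M ρ' (D.markSum μ) * y) = (s ρ' : ℤ) • (D.toV M ρ' (D.markSum μ') * y) +
      (slideSign o c i * s ρ' : ℤ) • (MvPolynomial.X m : MarkRing M) •
        D.forward M o c ρ ρ' (D.backward M o c ρ' ρ y) := by
  obtain ⟨x, rfl⟩ := D.toV_surjective ρ' y
  rw [backward_toV D hd.symm, forward_toV D hd, h.toV_markSum, add_mul, smul_add, smul_mul_assoc]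
  rw [add_assoc, eq_comm, add_eq_left]
  have hiff := hd.isSplit_iff (D := D)
  have h1 : ρ' c = true := by rw [hd.1, h0]; rfl
  have hc := D.circleOf_of_true h1
  have ht := arrowTail_eq o c
  by_cases hsp : D.IsSplit ρ c
  · rw [cut_of_isSplit D hsp, cut_of_not_isSplit D (fun h' => hiff.1 h' hsp), one_mul, map_mul]
    have e : D.toV M ρ' (D.pt M (Sum.inl (c, i + 2)) - D.pt M (Sum.inl (c, i))) =
        -((slideSign o c i : ℤ) • D.toV M ρ' (D.pt M (Sum.inl (c, arrowTail o c + 1)) -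
          D.pt M (Sum.inl (c, arrowTail o c + 1 + 2)))) := by
      unfold slideSign
      simp only [map_sub, toV_pt]
      rcases h.under with rfl | rfl <;> rcases ht with ht | ht <;> rw [ht] <;>
        simp [show (2 + 2 : Fin 4) = 0 from rfl, show (2 + 1 : Fin 4) = 3 from rfl,
          show (1 + 2 : Fin 4) = 3 from rfl, show (3 + 2 : Fin 4) = 1 from rfl, hc.1, hc.2]
    rw [e]
    simp only [neg_mul, smul_neg, smul_mul_assoc]
    rw [neg_add_eq_zero, smul_comm (MvPolynomial.X m : MarkRing M) (slideSign o c i : ℤ), smul_smul,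
      mul_comm]
  · rw [cut_of_not_isSplit D hsp, cut_of_isSplit D (hiff.2 hsp), one_mul]
    rw [toV_sub_of_isSplit D (hiff.2 hsp), map_mul, toV_sub_of_isSplit D (hiff.2 hsp)]
    simp

/-- The identity `d_v' H = H d_v`. By `toV_opposite_mul_cut` the slide does not affect the left-hand
side, and the change of `s` along the edge offsets the commutation of the marks with the factor of
the surgery. -/
lemma SlidesUnder.markSum_mul_backward {μ μ' : M → D.Point} {m : M} {c : Fin n} {i : Fin 4}
    (h : D.SlidesUnder μ μ' m c i) (o : CrossingOrientation n) {s : Resolution n → ℤˣ}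
    (hs : D.IsVertexSign s) {ρ ρ' : Resolution n} (hd : DifferAt c ρ ρ') (h0 : ρ c = false)
    (y : D.V M ρ') :
    (s ρ : ℤ) • (D.toV M ρ (D.markSum μ') * D.backward M o c ρ' ρ y) =
      D.backward M o c ρ' ρ ((s ρ' : ℤ) • (D.toV M ρ' (D.markSum μ) * y)) := by
  obtain ⟨x, rfl⟩ := D.toV_surjective ρ' y
  have hsig := IsVertexSign.eq hs hd h0
  have hiff := hd.isSplit_iff (D := D)
  rw [map_zsmul, h.toV_markSum, add_mul, backward_toV D hd.symm, smul_mul_assoc, ← map_mul,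
    ← map_mul, ← map_mul, ← mul_assoc (_ - _), map_mul _ (_ * _) x, ← neg_sub, neg_mul, map_neg,
    toV_opposite_mul_cut D hd.symm, neg_zero, zero_mul, smul_zero, add_zero, backward_toV D hd.symm]
  by_cases hsp : D.IsSplit ρ c
  · rw [hsig.1 hsp, cut_of_not_isSplit D (fun h' => hiff.1 h' hsp), one_mul, one_mul]
  · rw [hsig.2 hsp, ← mul_assoc, markSum_mul_cut D μ (hiff.2 hsp), neg_mul, map_neg, smul_neg,
      Units.val_neg, neg_smul, mul_assoc]

lemma dTotal_apply (o : CrossingOrientation n) (μ : M → D.Point) (ε : Fin n → Resolution n → ℤˣ)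
    (s : Resolution n → ℤˣ) (x : D.Chain M) (ρ : Resolution n) :
    D.dTotal o μ ε s x ρ = (s ρ : ℤ) • (D.toV M ρ (D.markSum μ) * x ρ) + D.dOdd M o ε x ρ := by
  rw [dTotal, LinearMap.add_apply, Pi.add_apply, dV_apply]

/-- `id + H` commutes with the differentials. -/
lemma SlidesUnder.dTotal_comm {μ μ' : M → D.Point} {m : M} {c : Fin n} {i : Fin 4}
    (h : D.SlidesUnder μ μ' m c i) (o : CrossingOrientation n) {ε : Fin n → Resolution n → ℤˣ}
    (hε : D.IsSignAssignment M o ε) {s : Resolution n → ℤˣ} (hs : D.IsVertexSign s)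
    (x : D.Chain M) :
    D.dTotal o μ ε s x + D.slideMap o ε s m c i (D.dTotal o μ ε s x) =
      D.dTotal o μ' ε s (x + D.slideMap o ε s m c i x) := by
  have sq' : ∀ a : ℤˣ, (a * a : ℤ) = 1 := fun a => by
    rw [← Units.val_mul, ← sq, Int.units_sq, Units.val_one]
  funext ρ
  rw [map_add, Pi.add_apply, Pi.add_apply, dTotal_apply, dTotal_apply, dTotal_apply, slideMap_apply]
  cases h0 : ρ c
  · have hd : DifferAt c ρ (Function.update ρ c true) := differAt_update (by rw [h0]; rfl)
    set ρ' := Function.update ρ c true with hρ'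
    have h1 : ρ' c = true := by simp [hρ']
    have hback : Function.update ρ' c false = ρ := by
      rw [← h0]; exact hd.symm.eq_update.symm
    -- Here `d_odd` at a crossing other than `c` passes through `H` by `slide_face`. The part at `c`
    -- is subtracted because `d_c` does not map into a 0-resolution of `c`; it gives the diagonal
    -- term of `backward_forward`.
    have hodd : D.dOdd M o ε (D.slideMap o ε s m c i x) ρ =
        ((ε c ρ * s ρ' * slideSign o c i : ℤˣ) : ℤ) • (MvPolynomial.X m : MarkRing M) •
          D.backward M o c ρ' ρ (D.dOdd M o ε x ρ' -
            (ε c ρ : ℤ) • D.forward M o c ρ ρ' (x ρ)) := by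
      rw [dOdd_apply, dOdd_apply, ← Finset.add_sum_erase _ _ (Finset.mem_univ c),
        ← Finset.add_sum_erase _ _ (Finset.mem_univ c), if_pos h1, hback, add_sub_cancel_left,
        if_neg (by simp [h0]), zero_add, map_sum, Finset.smul_sum, Finset.smul_sum]
      refine Finset.sum_congr rfl fun e he => ?_
      have hec : e ≠ c := Finset.ne_of_mem_erase he
      by_cases hρe : ρ e = true
      · have hface : IsFace c e (Function.update ρ e false) (Function.update ρ' e false) ρ ρ' := by
          refine ⟨hec.symm, by simp [hec.symm, h0], by simp, ⟨?_, fun f hf => ?_⟩, hd, ?_, ?_⟩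
          · simp [hec.symm, h0, h1]
          · by_cases hfe : f = e
            · subst hfe; simp
            · simp [hfe, hρ', hf]
          · exact (differAt_update (by rw [hρe]; rfl)).symm
          · exact (differAt_update (by rw [hd.2 e hec, hρe]; rfl)).symm
        have hup : Function.update (Function.update ρ e false) c true =
            Function.update ρ' e false := by
          rw [hρ', Function.update_comm hec]
        rw [if_pos hρe, if_pos (by rw [hd.2 e hec, hρe]), slideMap_apply, if_pos hface.left, hup]
        have key := D.slide_face o hε hs hface (x (Function.update ρ' e false))
        have key2 := congrArg (fun z => (slideSign o c i : ℤ) •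
          (MvPolynomial.X m : MarkRing M) • z) key
        simp only [map_zsmul, map_smul, Units.val_mul]
        simp only [smul_comm (MvPolynomial.X m : MarkRing M), smul_smul] at key2 ⊢
        convert key2 using 2 <;> ring
      · rw [if_neg hρe, if_neg (by rw [hd.2 e hec]; exact hρe), map_zero, smul_zero, smul_zero]
    rw [if_pos rfl, hodd, slideMap_apply, if_pos h0, dTotal_apply, ← hρ',
      h.backward_forward o hs hd h0, map_add, ← h.markSum_mul_backward o hs hd h0, map_sub,
      map_zsmul]
    have hdiag : ((ε c ρ * s ρ' * slideSign o c i : ℤˣ) : ℤ) • (MvPolynomial.X m : MarkRing M) •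
        (ε c ρ : ℤ) • D.backward M o c ρ' ρ (D.forward M o c ρ ρ' (x ρ)) =
        (slideSign o c i * s ρ' : ℤ) • (MvPolynomial.X m : MarkRing M) •
          D.backward M o c ρ' ρ (D.forward M o c ρ ρ' (x ρ)) := by
      rw [smul_comm (MvPolynomial.X m : MarkRing M) (ε c ρ : ℤ), smul_smul]
      congr 1
      rw [Units.val_mul, Units.val_mul]
      linear_combination (s ρ' * slideSign o c i : ℤ) * sq' (ε c ρ)
    rw [smul_sub, smul_sub, hdiag, smul_add, smul_add, mul_smul_comm, mul_smul_comm,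
      smul_comm (s ρ : ℤ) (_ : ℤ), smul_comm (s ρ : ℤ) (MvPolynomial.X m : MarkRing M)]
    abel
  · have hd : DifferAt c (Function.update ρ c false) ρ :=
      (differAt_update (by rw [h0]; rfl)).symm
    rw [if_neg (by simp), slideMap_apply, if_neg (by simp [h0]), mul_zero, smul_zero, zero_add,
      add_zero, h.forward_backward o hd (by simp)]
    -- A step in a direction other than `c` comes from a 1-resolution of `c`, where the image of `H`
    -- is zero.
    have hodd : D.dOdd M o ε (D.slideMap o ε s m c i x) ρ =
        (slideSign o c i * s ρ : ℤ) • (MvPolynomial.X m : MarkRing M) •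
        D.forward M o c (Function.update ρ c false) ρ
          (D.backward M o c ρ (Function.update ρ c false) (x ρ)) := by
      have hup : Function.update (Function.update ρ c false) c true = ρ := by
        rw [Function.update_idem, ← h0, Function.update_eq_self]
      rw [dOdd_apply, Finset.sum_eq_single c]
      · rw [if_pos h0, slideMap_apply, if_pos (by simp), hup, map_zsmul, map_smul, smul_smul]
        congr 1
        rw [Units.val_mul, Units.val_mul, ← mul_assoc, ← mul_assoc, sq', one_mul, mul_comm]
      · intro e _ he
        have h0' : ¬ Function.update ρ e false c = false := by
          rw [Function.update_of_ne he.symm, h0]; simp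
        rw [slideMap_apply, if_neg h0', map_zero, smul_zero, ite_self]
      · simp
    rw [hodd]
    abel

end LinkDiagram
end TwistedOdd

theorem mainTheorem1 {n l : ℕ} {M : Type*} [Fintype M] (D : LinkDiagram n l)
    (o : CrossingOrientation n) (μ μ' : M → D.Point) (m : M) (c : Fin n) (i : Fin 4)
    (hslide : D.SlidesUnder μ μ' m c i)
    (ε : Fin n → Resolution n → ℤˣ) (hε : D.IsSignAssignment M o ε)
    (s : Resolution n → ℤˣ) (hs : D.IsVertexSign s) :
    (D.dTotal o μ ε s).comp (D.dTotal o μ ε s) = 0 ∧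
    (D.dTotal o μ' ε s).comp (D.dTotal o μ' ε s) = 0 ∧
    ∃ F : D.Chain M ≃ₗ[MarkRing M] D.Chain M,
      (∀ x, F (D.dTotal o μ ε s x) = D.dTotal o μ' ε s (F x)) ∧
      (∀ x, F x = x + D.slideMap o ε s m c i x) := by
  refine ⟨D.dTotal_comp_dTotal o μ hε.dOdd_comp_dOdd hs,
    D.dTotal_comp_dTotal o μ' hε.dOdd_comp_dOdd hs,
    LinearEquiv.ofLinearMap (LinearMap.id + D.slideMap o ε s m c i)
      (LinearMap.id - D.slideMap o ε s m c i) ?_ ?_,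
    fun x => ?_, fun x => rfl⟩
  · refine LinearMap.ext fun x => ?_
    simp [LinkDiagram.slideMap_comp_slideMap]
  · refine LinearMap.ext fun x => ?_
    simp [LinkDiagram.slideMap_comp_slideMap]
  · exact hslide.dTotal_comm o hε hs x
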